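/- Let $k$ be a field of characteristic zero, let $R=k[x_0,x_1,x_2,x_3]$ with the standard grading, let $Q\in R_2$ define a smooth quadric surface $\mathcal Q\subset\mathbb P^3$, and let $t\ge 0$. For $F\in R$ let $F^\perp=\{G\in R : G(\partial_{x_0},\dots,\partial_{x_3})F=0\}$. For a point $P=[\alpha_0:\dots:\alpha_3]\in\mathbb P^3(k)$ let $\ell=\sum_i\alpha_i x_i$ be its dual linear form (defined up to a non-zero scalar), and write $P=\ell^\vee$. 1. If $\mathcal Q$ has a $k$-rational point (for instance, if $k$ is algebraically closed), then $$(Q^t)^\perp=\bigl(\ell^{\,t+1}\ \big|\ \ell^\vee\in\mathcal Q(k)\bigr).$$ 2. $R/(Q^t)^\perp$ is a compressed artinian Gorenstein algebra of socle degree $2t$. That is, it is a graded artinian Gorenstein algebra of socle degree $2t$, and its Hilbert function is, in every degree, the largest possible among all graded artinian Gorenstein quotients of $R$ of socle degree $2t$. Explicitly, for $0\le i\le 2t$, $$\dim_k\,[R/(Q^t)^\perp]_i=\min\left\{\binom{i+3}{3},\binom{2t-i+3}{3}\right\}.$$ 3. Let $G$ be a $(t+2)\times(t+2)$ grid in $\mathcal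 Q$, i.e. the set of the $(t+2)^2$ intersection points of $t+2$ distinct lines of one ruling of $\mathcal Q$ with $t+2$ distinct lines of the other ruling (all lines defined over $k$). Then $$(Q^t)^\perp=\bigl(\ell^{\,t+1}\ \big|\ \ell^\vee\in G\bigr).$$ If $k$ is algebraically closed, such grids exist. -/

import Mathlib

open MvPolynomial
open scoped LinearAlgebra.Projectivization

noncomputable section

namespace QuadricPowers

/-! ### The differentiation action of polynomials on polynomials -/

section Action

open scoped IsMulCommutative

variable (k : Type*) [Field k] (n : ℕ)

/-- The partial derivative `∂/∂xᵢ` as a `k`-linear endomorphism of `k[x₀,…,xₙ₋₁]`. -/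
def partialEnd (i : Fin n) : Module.End k (MvPolynomial (Fin n) k) :=
  (pderiv i : Derivation k (MvPolynomial (Fin n) k) (MvPolynomial (Fin n) k)).toLinearMap

theorem partialEnd_apply (i : Fin n) (F : MvPolynomial (Fin n) k) :
    partialEnd k n i F = pderiv i F := rfl

/-- Partial derivatives commute. -/
theorem partialEnd_comm (i j : Fin n) :
    partialEnd k n i * partialEnd k n j = partialEnd k n j * partialEnd k n i := by
  let D : Fin n → Derivation k (MvPolynomial (Fin n) k) (MvPolynomial (Fin n) k) :=
    fun i => pderiv i
  have h : ⁅D i, D j⁆ = 0 := by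
    apply MvPolynomial.derivation_ext
    intro l
    rw [Derivation.commutator_apply]
    simp only [D, pderiv_X, Derivation.coe_zero, Pi.zero_apply, Pi.single_apply]
    split_ifs <;> simp
  refine LinearMap.ext fun F => ?_
  have hF := DFunLike.congr_fun h F
  rw [Derivation.commutator_apply, Derivation.coe_zero, Pi.zero_apply, sub_eq_zero] at hF
  exact hF

/-- The algebra of differential operators generated by the partial derivatives is commutative. -/
instance constCoeffOps_comm : IsMulCommutative (Algebra.adjoin k (Set.range (partialEnd k n))) :=
  Algebra.isMulCommutative_adjoin k (by
    rintro _ ⟨i, rfl⟩ _ ⟨j, rfl⟩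
    exact partialEnd_comm k n i j)

/-- The `k`-algebra homomorphism `G ↦ G(∂₀,…,∂ₙ₋₁)`, which substitutes `∂/∂xᵢ` for `xᵢ`. -/
def diffOp : MvPolynomial (Fin n) k →ₐ[k] Module.End k (MvPolynomial (Fin n) k) :=
  (Algebra.adjoin k (Set.range (partialEnd k n))).val.comp
    (aeval fun i => ⟨partialEnd k n i, Algebra.subset_adjoin ⟨i, rfl⟩⟩)

/-- The variable `xᵢ` acts as `∂/∂xᵢ`; as `diffOp` is an algebra homomorphism, this determines
the action. -/
theorem diffOp_X (i : Fin n) : diffOp k n (X i) = partialEnd k n i := by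
  change ((aeval (R := k) fun i => (⟨partialEnd k n i, Algebra.subset_adjoin ⟨i, rfl⟩⟩ :
    Algebra.adjoin k (Set.range (partialEnd k n)))) (X i)).val = _
  rw [aeval_X]

end Action

variable {k : Type*} [Field k] {n : ℕ}

/-- `F^⊥`, the ideal of all `G` with `G(∂₀,…,∂ₙ₋₁) F = 0`. -/
def perp (F : MvPolynomial (Fin n) k) : Ideal (MvPolynomial (Fin n) k) where
  carrier := {G | diffOp k n G F = 0}
  add_mem' {a b} ha hb := by
    simp only [Set.mem_ofPred_eq] at *
    rw [map_add, LinearMap.add_apply, ha, hb, add_zero]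
  zero_mem' := by simp
  smul_mem' c G hG := by
    simp only [Set.mem_ofPred_eq] at *
    rw [smul_eq_mul, map_mul, Module.End.mul_apply, hG, map_zero]

/-! ### Graded artinian Gorenstein quotients -/

section Gorenstein

attribute [local instance] MvPolynomial.gradedAlgebra

/-- The degree `i` component of `R/I`: the image of the forms of degree `i`. -/
def gradedPiece (I : Ideal (MvPolynomial (Fin n) k)) (i : ℕ) :
    Submodule k (MvPolynomial (Fin n) k ⧸ I) :=
  (homogeneousSubmodule (Fin n) k i).map (Ideal.Quotient.mkₐ k I).toLinearMap

/-- The Hilbert function `i ↦ dim_k [R/I]_i`. -/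
def hilbertFn (I : Ideal (MvPolynomial (Fin n) k)) (i : ℕ) : ℕ :=
  Module.finrank k (gradedPiece I i)

/-- The socle of `R/I`: the elements killed by the ideal `(x₀,…,xₙ₋₁)`. -/
def socle (I : Ideal (MvPolynomial (Fin n) k)) : Submodule k (MvPolynomial (Fin n) k ⧸ I) :=
  ⨅ i : Fin n, LinearMap.ker
    (LinearMap.mulLeft k (Ideal.Quotient.mk I (X i : MvPolynomial (Fin n) k)))

/-- `R/I` is a (standard graded) artinian Gorenstein algebra: `I` is homogeneous, `R/I` is
artinian, and its socle is one-dimensional over `k` (so that `I ≠ R`). -/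
structure IsArtinianGorenstein (I : Ideal (MvPolynomial (Fin n) k)) : Prop where
  homogeneous : I.IsHomogeneous (homogeneousSubmodule (Fin n) k)
  artinian : IsArtinianRing (MvPolynomial (Fin n) k ⧸ I)
  socle_dim : Module.finrank k (socle I) = 1

/-- The graded artinian algebra `R/I` has socle degree `j`: this is the largest degree in which
`R/I` is non-zero. -/
def HasSocleDegree (I : Ideal (MvPolynomial (Fin n) k)) (j : ℕ) : Prop :=
  IsGreatest {i | gradedPiece I i ≠ ⊥} j

/-- `R/I` is a compressed Gorenstein algebra of socle degree `j`: a graded artinian Gorenstein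
quotient of `R` of socle degree `j` whose Hilbert function is, in every degree, the largest
possible one among all graded artinian Gorenstein quotients of `R` of socle degree `j`. -/
structure IsCompressedGorenstein (I : Ideal (MvPolynomial (Fin n) k)) (j : ℕ) : Prop where
  gorenstein : IsArtinianGorenstein I
  socleDegree : HasSocleDegree I j
  maximal : ∀ J : Ideal (MvPolynomial (Fin n) k), IsArtinianGorenstein J → HasSocleDegree J j →
    ∀ i, hilbertFn J i ≤ hilbertFn I i

end Gorenstein

/-! ### Points, dual linear forms, lines and grids -/

section Geometry

/-- The hypersurface `F = 0` in projective space is smooth: over an algebraic closure of `k`, the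
form `F` and its first partial derivatives have no common zero other than the origin. -/
def IsSmoothHypersurface (F : MvPolynomial (Fin n) k) : Prop :=
  ∀ v : Fin n → AlgebraicClosure k, v ≠ 0 → aeval v F = 0 → ∃ i, aeval v (pderiv i F) ≠ 0

/-- The set of `k`-points of the projective hypersurface `F = 0`. -/
def points (F : MvPolynomial (Fin n) k) : Set (ℙ k (Fin n → k)) :=
  {P | ∀ v ∈ P.submodule, eval v F = 0}

/-- The linear form `∑ vᵢ xᵢ`, dual to the point with homogeneous coordinates `v`. -/
def linForm (v : Fin n → k) : MvPolynomial (Fin n) k := ∑ i, C (v i) * X i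

/-- The ideal `(ℓ^d | ℓ^∨ ∈ Y)` generated by the `d`-th powers of the linear forms dual to the
points of `Y`. -/
def powerIdeal (Y : Set (ℙ k (Fin n → k))) (d : ℕ) : Ideal (MvPolynomial (Fin n) k) :=
  Ideal.span {G | ∃ (v : Fin n → k) (hv : v ≠ 0),
    Projectivization.mk k v hv ∈ Y ∧ G = linForm v ^ d}

/-- `L` is a line of projective space (a two-dimensional linear subspace) lying on `F = 0`. -/
def IsLineOn (F : MvPolynomial (Fin n) k) (L : Submodule k (Fin n → k)) : Prop :=
  Module.finrank k L = 2 ∧ ∀ v ∈ L, eval v F = 0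

/-- Two lines on a smooth quadric surface belong to the same ruling iff they are equal or skew. -/
def SameRuling (L M : Submodule k (Fin n → k)) : Prop := L = M ∨ Disjoint L M

/-- The data of an `a × b` grid on a smooth quadric surface `Q = 0`: `a` distinct lines in one
ruling and `b` distinct lines in the other. -/
structure IsGrid (Q : MvPolynomial (Fin 4) k) {a b : ℕ}
    (L : Fin a → Submodule k (Fin 4 → k)) (M : Fin b → Submodule k (Fin 4 → k)) : Prop where
  lineOn_left : ∀ i, IsLineOn Q (L i)
  lineOn_right : ∀ j, IsLineOn Q (M j)
  injective_left : Function.Injective L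
  injective_right : Function.Injective M
  ruling_left : ∀ i i', SameRuling (L i) (L i')
  ruling_right : ∀ j j', SameRuling (M j) (M j')
  opposite : ∀ i j, ¬ SameRuling (L i) (M j)

/-- The points of the grid: the intersection points of a line `L i` with a line `M j`. -/
def gridPoints {a b : ℕ} (L : Fin a → Submodule k (Fin 4 → k))
    (M : Fin b → Submodule k (Fin 4 → k)) : Set (ℙ k (Fin 4 → k)) :=
  {P | ∃ i j, P.submodule ≤ L i ⊓ M j}

end Geometry

end QuadricPowers

end

noncomputable section

namespace QuadricPowers

/-! ### Differentiation, Euler's identity, powers of linear forms -/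

section Action

variable {k : Type*} [Field k] {n : ℕ}

/-! Two features of Q drive everything. Its Hessian is invertible, so there is a dual quadric whose
Laplace-type operator sends Q^(t+1) to a non-zero multiple of Q^t. And modulo Q, an operator G of
order i sends Q^i to i! times G evaluated at the gradient of Q. Together they show that no non-zero
form of degree at most t kills Q^t (`eq_zero_of_diffOp_pow_eq_zero`). Hence the Hilbert function is
full up to degree t, and by apolarity it is symmetric beyond. The socle pairing shows that no
Gorenstein algebra of socle degree 2t can do better.

For the generators, D^(t+1) kills Q^t when D is differentiation along an isotropic vector, since
then D²Q = 0. Conversely, let G of degree d > t kill Q^t and lie outside the power ideal. Apolarity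
turns a functional separating G from the ideal into a form F of degree d, killed by the degree d
part of the ideal. Such an F vanishes to order d - t on the quadric (`pow_dvd_of_apolar`). By a
dimension count, F is then a derivative of Q^t (`exists_diffOp_pow_eq_pow_mul`), so G kills F, a
contradiction. Rational points suffice here because stereographic projection from one of them makes
them dense (`dvd_of_forall_eval_eq_zero`).

For the grid, the d-th powers attached to d + 1 points of a line span those of the whole line. Hence
t + 2 grid points capture each line of the first family, and a transversal through any other point
of the quadric meets t + 2 such lines. -/

theorem diffOp_C (c : k) (F : MvPolynomial (Fin n) k) : diffOp k n (C c) F = C c * F := by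
  rw [← algebraMap_eq, AlgHom.commutes, Module.algebraMap_end_apply, Algebra.smul_def]

theorem diffOp_X_apply (i : Fin n) (F : MvPolynomial (Fin n) k) :
    diffOp k n (X i) F = pderiv i F := by
  rw [diffOp_X, partialEnd_apply]

theorem diffOp_mul_apply (G H F : MvPolynomial (Fin n) k) :
    diffOp k n (G * H) F = diffOp k n G (diffOp k n H F) := by
  rw [map_mul, Module.End.mul_apply]

theorem diffOp_C_mul (c : k) (G F : MvPolynomial (Fin n) k) :
    diffOp k n (C c * G) F = C c * diffOp k n G F := by
  rw [diffOp_mul_apply, diffOp_C]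

theorem diffOp_sum_apply {ι : Type*} (s : Finset ι) (G : ι → MvPolynomial (Fin n) k)
    (F : MvPolynomial (Fin n) k) :
    diffOp k n (∑ i ∈ s, G i) F = ∑ i ∈ s, diffOp k n (G i) F := by
  rw [map_sum, LinearMap.sum_apply]

theorem mem_perp {F G : MvPolynomial (Fin n) k} : G ∈ perp F ↔ diffOp k n G F = 0 := Iff.rfl

/-- Induction on the degree of a homogeneous polynomial, by Euler's identity. -/
theorem homogeneous_induction [CharZero k] {P : ℕ → MvPolynomial (Fin n) k → Prop}
    (hC : ∀ c, P 0 (C c)) (hadd : ∀ i G H, P i G → P i H → P i (G + H)) (hzero : ∀ i, P i 0)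
    (hX : ∀ i j (c : k) G, G.IsHomogeneous i → P i G → P (i + 1) (G * (C c * X j)))
    {i : ℕ} {G : MvPolynomial (Fin n) k} (hG : G.IsHomogeneous i) : P i G := by
  induction i generalizing G with
  | zero =>
    rw [← totalDegree_zero_iff_isHomogeneous, totalDegree_eq_zero_iff_eq_C] at hG
    rw [hG]
    exact hC _
  | succ i ih =>
    have h0 : ((i + 1 : ℕ) : k) ≠ 0 := Nat.cast_ne_zero.2 i.succ_ne_zero
    have hE := hG.sum_X_mul_pderiv
    have hG' : G = ∑ j, pderiv j G * (C ((i + 1 : ℕ) : k)⁻¹ * X j) := by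
      calc G = C ((i + 1 : ℕ) : k)⁻¹ * ((i + 1) • G) := by
            rw [nsmul_eq_mul, ← map_natCast (C (σ := Fin n) (R := k)), ← mul_assoc, ← C_mul,
              inv_mul_cancel₀ h0, C_1, one_mul]
        _ = _ := by
            rw [← hE, Finset.mul_sum]
            exact Finset.sum_congr rfl fun j _ => by ring
    rw [hG']
    refine Finset.sum_induction _ (P (i + 1)) (hadd _) (hzero _) fun j _ => ?_
    exact hX _ _ _ _ hG.pderiv (ih hG.pderiv)

theorem diffOp_isHomogeneous [CharZero k] {i e : ℕ} {G F : MvPolynomial (Fin n) k}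
    (hG : G.IsHomogeneous i) (hF : F.IsHomogeneous (i + e)) :
    (diffOp k n G F).IsHomogeneous e := by
  refine homogeneous_induction (P := fun i G => ∀ F : MvPolynomial (Fin n) k,
    F.IsHomogeneous (i + e) → (diffOp k n G F).IsHomogeneous e) ?_ ?_ ?_ ?_ hG F hF
  · intro c F hF
    rw [diffOp_C]
    simpa using hF.C_mul c
  · intro i G H hG hH F hF
    rw [map_add, LinearMap.add_apply]
    exact (hG F hF).add (hH F hF)
  · intro i F _
    rw [map_zero, LinearMap.zero_apply]
    exact isHomogeneous_zero _ _ _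
  · intro i j c G _ ih F hF
    rw [diffOp_mul_apply, diffOp_C_mul, diffOp_X_apply]
    refine ih _ (IsHomogeneous.C_mul ?_ c)
    have := hF.pderiv (i := j)
    rwa [show i + 1 + e - 1 = i + e by omega] at this

theorem diffOp_eq_zero_of_lt [CharZero k] {i j : ℕ} {G F : MvPolynomial (Fin n) k}
    (hG : G.IsHomogeneous i) (hF : F.IsHomogeneous j) (hij : j < i) : diffOp k n G F = 0 := by
  refine homogeneous_induction (P := fun i G => ∀ j (F : MvPolynomial (Fin n) k),
    F.IsHomogeneous j → j < i → diffOp k n G F = 0) ?_ ?_ ?_ ?_ hG j F hF hij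
  · intro c j F _ h
    omega
  · intro i G H hG hH j F hF h
    rw [map_add, LinearMap.add_apply, hG j F hF h, hH j F hF h, add_zero]
  · intro _ j F _ _
    rw [map_zero, LinearMap.zero_apply]
  · intro _ j c G _ ih d F hF hd
    rw [diffOp_mul_apply, diffOp_C_mul, diffOp_X_apply]
    rcases Nat.eq_zero_or_pos d with rfl | hpos
    · rw [← totalDegree_zero_iff_isHomogeneous, totalDegree_eq_zero_iff_eq_C] at hF
      rw [hF, pderiv_C, mul_zero, map_zero]
    · exact ih (d - 1) _ (hF.pderiv.C_mul c) (by omega)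

theorem linForm_isHomogeneous (v : Fin n → k) : (linForm v).IsHomogeneous 1 :=
  IsHomogeneous.sum _ _ _ fun _ _ => isHomogeneous_C_mul_X _ _

theorem diffOp_linForm (v : Fin n → k) (F : MvPolynomial (Fin n) k) :
    diffOp k n (linForm v) F = ∑ i, C (v i) * pderiv i F := by
  simp only [linForm, diffOp_sum_apply, diffOp_C_mul, diffOp_X_apply]

theorem diffOp_linForm_mul (v : Fin n → k) (F G : MvPolynomial (Fin n) k) :
    diffOp k n (linForm v) (F * G) =
      diffOp k n (linForm v) F * G + F * diffOp k n (linForm v) G := by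
  simp only [diffOp_linForm, Derivation.leibniz, smul_eq_mul, Finset.sum_mul, Finset.mul_sum,
    ← Finset.sum_add_distrib]
  exact Finset.sum_congr rfl fun i _ => by ring

theorem eval_diffOp_linForm {d : ℕ} (v : Fin n → k) {F : MvPolynomial (Fin n) k}
    (hF : F.IsHomogeneous d) : eval v (diffOp k n (linForm v) F) = d * eval v F := by
  have h := congrArg (eval v) hF.sum_X_mul_pderiv
  simpa [diffOp_linForm] using h

/-- The `d`-th power of a linear form acts on forms of degree `d` as evaluation at the dual
point, up to the factor `d!`. -/
theorem diffOp_linForm_pow [CharZero k] {d : ℕ} (v : Fin n → k) {F : MvPolynomial (Fin n) k}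
    (hF : F.IsHomogeneous d) :
    diffOp k n (linForm v ^ d) F = C (d.factorial * eval v F) := by
  induction d generalizing F with
  | zero =>
    rw [← totalDegree_zero_iff_isHomogeneous, totalDegree_eq_zero_iff_eq_C] at hF
    rw [hF]
    simp
  | succ d ih =>
    have h1 : (diffOp k n (linForm v) F).IsHomogeneous d :=
      diffOp_isHomogeneous (linForm_isHomogeneous v) (by rwa [add_comm])
    rw [pow_succ, diffOp_mul_apply, ih h1, eval_diffOp_linForm v hF, Nat.factorial_succ]
    push_cast
    ring_nf

/-- Testing against d-th powers of linear forms evaluates F at every point, and k is infinite. -/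
theorem eq_zero_of_diffOp_eq_zero [CharZero k] {d : ℕ} {F : MvPolynomial (Fin n) k}
    (hF : F.IsHomogeneous d)
    (h : ∀ G : MvPolynomial (Fin n) k, G.IsHomogeneous d → diffOp k n G F = 0) : F = 0 := by
  refine hF.eq_zero_of_forall_eval_eq_zero fun v => ?_
  have hv := h (linForm v ^ d) (by simpa using (linForm_isHomogeneous v).pow d)
  rw [diffOp_linForm_pow v hF, C_eq_zero] at hv
  exact (mul_eq_zero.1 hv).resolve_left (Nat.cast_ne_zero.2 d.factorial_ne_zero)

end Action

/-! ### Dimension of the space of forms of degree d -/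

section Dimension

variable (k : Type*) [Field k]

instance finite_homogeneousSubmodule (n d : ℕ) :
    Module.Finite k (homogeneousSubmodule (Fin n) k d) :=
  Module.Finite.iff_fg.2 (homogeneousSubmodule_fg (Fin n) k d)

theorem finrank_homogeneousSubmodule (n d : ℕ) :
    Module.finrank k (homogeneousSubmodule (Fin n) k d) = n.multichoose d := by
  rw [homogeneousSubmodule_eq_finsupp_supported]
  have hs : {m : Fin n →₀ ℕ | m.degree = d} =
      ((Finset.univ : Finset (Fin n)).finsuppAntidiag d : Set (Fin n →₀ ℕ)) := by
    ext m
    simp [Finset.mem_finsuppAntidiag, Finsupp.degree_eq_sum]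
  rw [hs, (AddMonoidAlgebra.supportedEquivFinsupp _).finrank_eq,
    Module.finrank_finsupp_self]
  refine (Fintype.card_coe _).trans ?_
  rw [Finset.card_finsuppAntidiag_nat_eq_multichoose, Finset.card_univ, Fintype.card_fin]

end Dimension

/-! ### Derivatives of powers of a nondegenerate quadric -/

section Powers

variable {k : Type*} [Field k] {n : ℕ}

/-- The gradient substitution `G ↦ G(∂₀Q,…,∂ₙ₋₁Q)`. -/
def gradSubst (Q : MvPolynomial (Fin n) k) :
    MvPolynomial (Fin n) k →ₐ[k] MvPolynomial (Fin n) k :=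
  aeval fun i => pderiv i Q

theorem pderiv_pow_succ_mul (Q H : MvPolynomial (Fin n) k) (m : ℕ) (j : Fin n) :
    pderiv j (Q ^ (m + 1) * H) =
      Q ^ m * (C ((m + 1 : ℕ) : k) * pderiv j Q * H + Q * pderiv j H) := by
  rw [Derivation.leibniz, Derivation.leibniz_pow]
  simp only [smul_eq_mul, nsmul_eq_mul, Nat.add_sub_cancel, map_natCast]
  ring

/-- Applying an operator of order `i` lowers the order of vanishing along `Q = 0` by at most
`i`. -/
theorem pow_dvd_diffOp [CharZero k] (Q : MvPolynomial (Fin n) k) {i : ℕ} (e : ℕ)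
    {G : MvPolynomial (Fin n) k} (hG : G.IsHomogeneous i) (H : MvPolynomial (Fin n) k) :
    Q ^ e ∣ diffOp k n G (Q ^ (e + i) * H) := by
  refine homogeneous_induction (P := fun i G => ∀ H : MvPolynomial (Fin n) k,
    Q ^ e ∣ diffOp k n G (Q ^ (e + i) * H)) ?_ ?_ ?_ ?_ hG H
  · intro c H
    rw [diffOp_C]
    rw [add_zero, mul_left_comm]
    exact dvd_mul_right _ _
  · intro i G G' hG hG' H
    rw [map_add, LinearMap.add_apply]
    exact dvd_add (hG H) (hG' H)
  · intro i H
    rw [map_zero, LinearMap.zero_apply]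
    exact dvd_zero _
  · intro i j c G _ ih H
    -- One derivative costs one factor Q; the remaining bracket becomes the new H, which is why H is
    -- arbitrary.
    rw [diffOp_mul_apply, diffOp_C_mul, diffOp_X_apply, ← add_assoc, pderiv_pow_succ_mul,
      mul_left_comm]
    exact ih _

/-- The leading term along `Q = 0` of an operator of order `i` applied to `Q ^ i * H`. -/
theorem dvd_diffOp_pow_mul_sub [CharZero k] (Q : MvPolynomial (Fin n) k) {i : ℕ}
    {G : MvPolynomial (Fin n) k} (hG : G.IsHomogeneous i) (H : MvPolynomial (Fin n) k) :
    Q ∣ diffOp k n G (Q ^ i * H) - C (i.factorial : k) * gradSubst Q G * H := by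
  refine homogeneous_induction (P := fun i G => ∀ H : MvPolynomial (Fin n) k,
    Q ∣ diffOp k n G (Q ^ i * H) - C (i.factorial : k) * gradSubst Q G * H) ?_ ?_ ?_ ?_ hG H
  · intro c H
    rw [diffOp_C, gradSubst, aeval_C, algebraMap_eq]
    simp
  · intro i G G' hG hG' H
    rw [map_add, LinearMap.add_apply, map_add]
    convert dvd_add (hG H) (hG' H) using 1
    ring
  · intro i H
    simp
  · intro i j c G _ ih H
    rw [diffOp_mul_apply, diffOp_C_mul, diffOp_X_apply, pderiv_pow_succ_mul, mul_left_comm]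
    obtain ⟨K, hK⟩ := ih (C c * (C ((i + 1 : ℕ) : k) * pderiv j Q * H + Q * pderiv j H))
    -- The summand Q * ∂ⱼH of the new H is divisible by Q, so its leading term moves into the
    -- cofactor.
    refine ⟨K + C (i.factorial : k) * gradSubst Q G * C c * pderiv j H, ?_⟩
    have hX : gradSubst Q (C c * X j) = C c * pderiv j Q := by
      rw [gradSubst, map_mul, aeval_C, aeval_X, algebraMap_eq]
    rw [sub_eq_iff_eq_add.1 hK, map_mul, hX, Nat.factorial_succ, Nat.cast_mul, C_mul]
    ring

/-- The (constant) Hessian matrix of a quadratic form. -/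
def hessian (Q : MvPolynomial (Fin n) k) : Matrix (Fin n) (Fin n) k :=
  fun i j => coeff 0 (pderiv i (pderiv j Q))

theorem pderiv_pderiv_comm (F : MvPolynomial (Fin n) k) (i j : Fin n) :
    pderiv i (pderiv j F) = pderiv j (pderiv i F) :=
  LinearMap.congr_fun (partialEnd_comm k n i j) F

theorem hessian_transpose (Q : MvPolynomial (Fin n) k) : (hessian Q).transpose = hessian Q := by
  ext i j
  rw [Matrix.transpose_apply, hessian, hessian, pderiv_pderiv_comm]

theorem pderiv_pderiv_eq_hessian {Q : MvPolynomial (Fin n) k} (hQ : Q.IsHomogeneous 2)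
    (i j : Fin n) : pderiv i (pderiv j Q) = C (hessian Q i j) := by
  have h : (pderiv i (pderiv j Q)).IsHomogeneous 0 := hQ.pderiv.pderiv
  rw [← totalDegree_zero_iff_isHomogeneous, totalDegree_eq_zero_iff_eq_C] at h
  exact h

theorem pderiv_eq_linForm {Q : MvPolynomial (Fin n) k} (hQ : Q.IsHomogeneous 2) (j : Fin n) :
    pderiv j Q = linForm (hessian Q j) := by
  have h := (show (pderiv j Q).IsHomogeneous 1 from hQ.pderiv).sum_X_mul_pderiv
  rw [one_smul] at h
  rw [← h, linForm]
  refine Finset.sum_congr rfl fun i _ => ?_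
  rw [pderiv_pderiv_comm, pderiv_pderiv_eq_hessian hQ, mul_comm]

theorem eval_linForm (v w : Fin n → k) : eval w (linForm v) = v ⬝ᵥ w := by
  simp [linForm, dotProduct]

theorem linForm_eq_zero {v : Fin n → k} : linForm v = 0 ↔ v = 0 := by
  refine ⟨fun h => ?_, fun h => by simp [h, linForm]⟩
  refine dotProduct_eq_zero v fun w => ?_
  rw [← eval_linForm, h, map_zero]

theorem eval_pderiv {Q : MvPolynomial (Fin n) k} (hQ : Q.IsHomogeneous 2) (j : Fin n)
    (v : Fin n → k) : eval v (pderiv j Q) = (hessian Q).mulVec v j := by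
  rw [pderiv_eq_linForm hQ, eval_linForm]
  rfl

theorem eq_zero_of_gradient_eq_zero [CharZero k] {Q : MvPolynomial (Fin n) k}
    (hQ : Q.IsHomogeneous 2) (hsmooth : IsSmoothHypersurface Q) {v : Fin n → k}
    (hv : ∀ i, eval v (pderiv i Q) = 0) : v = 0 := by
  by_contra hne
  have hev : ∀ P : MvPolynomial (Fin n) k,
      aeval (fun i => algebraMap k (AlgebraicClosure k) (v i)) P =
        algebraMap k (AlgebraicClosure k) (eval v P) := fun P => by
    rw [← MvPolynomial.coe_aeval_eq_eval]
    exact aeval_algebraMap_apply _ v P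
  have hQv : eval v Q = 0 := by
    have h := congrArg (eval v) hQ.sum_X_mul_pderiv
    simpa [hv] using h
  obtain ⟨i, hi⟩ := hsmooth (fun i => algebraMap k (AlgebraicClosure k) (v i))
    (fun h => hne (funext fun i => by simpa using congrFun h i)) (by rw [hev, hQv, map_zero])
  exact hi (by rw [hev, hv, map_zero])

/-- The gradient at v is the Hessian applied to v, so a kernel vector would be a singular point. -/
theorem isUnit_det_hessian [CharZero k] {Q : MvPolynomial (Fin n) k}
    (hQ : Q.IsHomogeneous 2) (hsmooth : IsSmoothHypersurface Q) : IsUnit (hessian Q).det := by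
  rw [isUnit_iff_ne_zero]
  intro h
  obtain ⟨v, hv, hAv⟩ := Matrix.exists_mulVec_eq_zero_iff.2 h
  exact hv (eq_zero_of_gradient_eq_zero hQ hsmooth fun i => by rw [eval_pderiv hQ, hAv]; rfl)

/-- The quadratic form dual to `Q`. -/
def dualQuadric (Q : MvPolynomial (Fin n) k) : MvPolynomial (Fin n) k :=
  C (2 : k)⁻¹ * ∑ j, linForm ((hessian Q)⁻¹ j) * X j

theorem sum_linForm_smul (v : Fin n → k) (B : Matrix (Fin n) (Fin n) k) :
    ∑ j, C (v j) * linForm (B j) = linForm (Matrix.vecMul v B) := by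
  simp only [linForm, Finset.mul_sum, Matrix.vecMul, dotProduct, map_sum, Finset.sum_mul, map_mul]
  rw [Finset.sum_comm]
  exact Finset.sum_congr rfl fun _ _ => Finset.sum_congr rfl fun _ _ => by ring

theorem sum_linForm_one (i : Fin n) : linForm ((1 : Matrix (Fin n) (Fin n) k) i) = X i := by
  simp [linForm, Matrix.one_apply]

theorem aeval_linForm (B : Matrix (Fin n) (Fin n) k) (v : Fin n → k) :
    aeval (fun i => linForm (B i)) (linForm v) = linForm (Matrix.vecMul v B) := by
  rw [← sum_linForm_smul, linForm, map_sum]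
  exact Finset.sum_congr rfl fun i _ => by rw [map_mul, aeval_C, aeval_X, algebraMap_eq]

/-- The substitution by the inverse Hessian undoes the gradient substitution and carries Q to its
dual. -/
theorem dualQuadric_dvd [CharZero k] {Q : MvPolynomial (Fin n) k} (hQ : Q.IsHomogeneous 2)
    (hdet : IsUnit (hessian Q).det) {G : MvPolynomial (Fin n) k} (h : Q ∣ gradSubst Q G) :
    dualQuadric Q ∣ G := by
  let σ : MvPolynomial (Fin n) k →ₐ[k] MvPolynomial (Fin n) k :=
    aeval fun i => linForm ((hessian Q)⁻¹ i)
  have hL : ∀ i, σ (linForm (hessian Q i)) = X i := fun i => by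
    rw [← sum_linForm_one, ← Matrix.mul_nonsing_inv _ hdet]
    exact aeval_linForm _ _
  have hσ : σ (gradSubst Q G) = G := by
    have : σ.comp (gradSubst Q) = AlgHom.id k _ := by
      refine algHom_ext fun i => ?_
      simp only [AlgHom.comp_apply, gradSubst, aeval_X, AlgHom.id_apply]
      rw [pderiv_eq_linForm hQ, hL]
    exact DFunLike.congr_fun this G
  have hσQ : σ Q = dualQuadric Q := by
    have h2 : Q = C (2 : k)⁻¹ * ∑ j, X j * linForm (hessian Q j) := by
      have hE := hQ.sum_X_mul_pderiv
      simp only [pderiv_eq_linForm hQ] at hE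
      rw [hE, nsmul_eq_mul, Nat.cast_two, ← map_ofNat (C (σ := Fin n) (R := k)) 2, ← mul_assoc,
        ← C_mul, inv_mul_cancel₀ two_ne_zero, C_1, one_mul]
    conv_lhs => rw [h2]
    rw [map_mul, map_sum, dualQuadric]
    congr 1
    · rw [← algebraMap_eq, AlgHom.commutes]
    · refine Finset.sum_congr rfl fun j _ => ?_
      rw [map_mul, hL]
      congr 1
      exact aeval_X _ _
  rw [← hσ, ← hσQ]
  exact map_dvd σ h

theorem dualQuadric_isHomogeneous (Q : MvPolynomial (Fin n) k) :
    (dualQuadric Q).IsHomogeneous 2 :=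
  IsHomogeneous.C_mul (IsHomogeneous.sum _ _ _ fun _ _ =>
    (linForm_isHomogeneous _).mul (isHomogeneous_X _ _)) _

/-- The Laplace operator of `Q` maps `Q ^ (t + 1)` to a multiple of `Q ^ t`. -/
theorem diffOp_dualQuadric_pow [CharZero k] {Q : MvPolynomial (Fin n) k}
    (hQ : Q.IsHomogeneous 2) (hdet : IsUnit (hessian Q).det) (t : ℕ) :
    diffOp k n (dualQuadric Q) (Q ^ (t + 1)) =
      C (((t + 1 : ℕ) : k) * (((2 * t + n : ℕ) : k) * 2⁻¹)) * Q ^ t := by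
  set A := hessian Q with hA
  have h1 : ∀ j, diffOp k n (linForm (A⁻¹ j)) Q = X j := fun j => by
    rw [diffOp_linForm, ← sum_linForm_one, ← Matrix.nonsing_inv_mul _ hdet]
    exact (Finset.sum_congr rfl fun i _ => by rw [pderiv_eq_linForm hQ]).trans
      (sum_linForm_smul _ _)
  have hpow : ∀ j, pderiv j (Q ^ (t + 1)) = C ((t + 1 : ℕ) : k) * (Q ^ t * pderiv j Q) :=
    fun j => by
      have := pderiv_pow_succ_mul Q 1 t j
      rw [mul_one] at this
      rw [this, (pderiv j).map_one_eq_zero]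
      ring
  have h2 : ∀ j, diffOp k n (linForm (A⁻¹ j)) (Q ^ t) * pderiv j Q =
      C (t : k) * Q ^ (t - 1) * (X j * pderiv j Q) := fun j => by
    have : diffOp k n (linForm (A⁻¹ j)) (Q ^ t) = C (t : k) * Q ^ (t - 1) * X j := by
      rw [← h1 j, diffOp_linForm, diffOp_linForm, Finset.mul_sum]
      refine Finset.sum_congr rfl fun i _ => ?_
      rw [Derivation.leibniz_pow]
      simp only [smul_eq_mul, nsmul_eq_mul, map_natCast]
      ring
    rw [this]
    ring
  -- The trace of A⁻¹A: this is where n enters the constant.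
  have h3 : ∑ j, diffOp k n (linForm (A⁻¹ j)) (pderiv j Q) = C (n : k) := by
    have : ∀ j, diffOp k n (linForm (A⁻¹ j)) (pderiv j Q) = C ((A⁻¹ * A) j j) := fun j => by
      simp only [diffOp_linForm, pderiv_pderiv_eq_hessian hQ, Matrix.mul_apply, map_sum, map_mul]
      rfl
    simp only [this, Matrix.nonsing_inv_mul _ hdet, Matrix.one_apply_eq]
    simp
  rw [dualQuadric, diffOp_C_mul, diffOp_sum_apply]
  have h4 : ∀ j, diffOp k n (linForm (A⁻¹ j) * X j) (Q ^ (t + 1)) =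
      C ((t + 1 : ℕ) : k) * (C (t : k) * Q ^ (t - 1) * (X j * pderiv j Q) +
        Q ^ t * diffOp k n (linForm (A⁻¹ j)) (pderiv j Q)) := fun j => by
    rw [diffOp_mul_apply, diffOp_X_apply, hpow, ← diffOp_C, ← diffOp_mul_apply, mul_comm,
      diffOp_mul_apply, diffOp_C, diffOp_linForm_mul, h2]
  rw [Finset.sum_congr rfl fun j _ => h4 j, ← Finset.mul_sum, Finset.sum_add_distrib,
    ← Finset.mul_sum, ← Finset.mul_sum, h3,
    hQ.sum_X_mul_pderiv]
  -- For t = 0 the truncated exponent t - 1 is harmless, because its coefficient is zero.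
  have h5 : C (t : k) * Q ^ (t - 1) * (2 • Q) = C ((2 * t : ℕ) : k) * Q ^ t := by
    cases t with
    | zero => simp
    | succ t =>
      simp only [Nat.add_sub_cancel, nsmul_eq_mul, map_natCast, pow_succ]
      push_cast
      ring
  rw [h5, Nat.cast_add (2 * t) n]
  simp only [C_mul, C_add]
  ring

theorem C_laplaceConst_ne_zero [CharZero k] (hn : 0 < n) (t : ℕ) :
    (C (((t + 1 : ℕ) : k) * (((2 * t + n : ℕ) : k) * 2⁻¹)) : MvPolynomial (Fin n) k) ≠ 0 :=
  (C_eq_zero (σ := Fin n)).not.2 (mul_ne_zero (Nat.cast_ne_zero.2 (by omega))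
    (mul_ne_zero (Nat.cast_ne_zero.2 (by omega)) (inv_ne_zero two_ne_zero)))

attribute [local instance] MvPolynomial.gradedAlgebra in
theorem exists_isHomogeneous_of_dvd {a d : ℕ} {A F : MvPolynomial (Fin n) k}
    (hA : A.IsHomogeneous a) (hF : F.IsHomogeneous d) (h : A ∣ F) :
    F = 0 ∨ a ≤ d ∧ ∃ H : MvPolynomial (Fin n) k, H.IsHomogeneous (d - a) ∧ F = A * H := by
  obtain ⟨H, rfl⟩ := h
  have hd : ((DirectSum.decompose (homogeneousSubmodule (Fin n) k) (A * H) d :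
      homogeneousSubmodule (Fin n) k d) : MvPolynomial (Fin n) k) = A * H :=
    DirectSum.decompose_of_mem_same _ hF
  rcases le_or_gt a d with had | had
  · refine Or.inr ⟨had, _, (DirectSum.decompose (homogeneousSubmodule (Fin n) k) H (d - a)).2, ?_⟩
    rw [← DirectSum.coe_decompose_mul_of_left_mem_of_le _ hA had, hd]
  · left
    rw [← hd, DirectSum.coe_decompose_mul_of_left_mem_of_not_le _ hA (not_le.2 had)]

/-- If i < t, the Laplace operator commutes with G and lowers the exponent t. If i = t, the leading
term modulo Q makes the dual quadric divide G; the Laplace operator absorbs that factor, leaving a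
cofactor of degree i - 2 that kills Q^(t-1). -/
theorem eq_zero_of_diffOp_pow_eq_zero [CharZero k] (hn : 0 < n) {Q : MvPolynomial (Fin n) k}
    (hQ : Q.IsHomogeneous 2) (hdet : IsUnit (hessian Q).det) {i t : ℕ} (hit : i ≤ t)
    {G : MvPolynomial (Fin n) k} (hG : G.IsHomogeneous i) (h : diffOp k n G (Q ^ t) = 0) :
    G = 0 := by
  induction t using Nat.strong_induction_on generalizing i G with
  | _ t ih =>
  rcases hit.lt_or_eq with hlt | rfl
  · obtain ⟨t, rfl⟩ : ∃ s, t = s + 1 := ⟨t - 1, by omega⟩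
    refine ih t t.lt_succ_self (Nat.le_of_lt_succ hlt) hG ?_
    have h' := diffOp_mul_apply (dualQuadric Q) G (Q ^ (t + 1))
    rw [h, map_zero, mul_comm, diffOp_mul_apply, diffOp_dualQuadric_pow hQ hdet, ← diffOp_C,
      ← diffOp_mul_apply, mul_comm, diffOp_mul_apply, diffOp_C] at h'
    exact (mul_eq_zero.1 h').resolve_left (C_laplaceConst_ne_zero hn t)
  · have hdvd : Q ∣ gradSubst Q G := by
      have h1 := dvd_diffOp_pow_mul_sub Q hG 1
      rw [mul_one, mul_one, h, zero_sub, dvd_neg] at h1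
      have hu : IsUnit (C (i.factorial : k) : MvPolynomial (Fin n) k) :=
        (isUnit_iff_ne_zero.2 (Nat.cast_ne_zero.2 i.factorial_ne_zero)).map C
      exact (hu.dvd_mul_left).1 h1
    rcases exists_isHomogeneous_of_dvd (dualQuadric_isHomogeneous Q) hG
      (dualQuadric_dvd hQ hdet hdvd) with h0 | ⟨h2, H, hH, rfl⟩
    · exact h0
    obtain ⟨t, rfl⟩ : ∃ s, i = s + 1 := ⟨i - 1, by omega⟩
    rw [mul_comm, diffOp_mul_apply, diffOp_dualQuadric_pow hQ hdet, ← diffOp_C,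
      ← diffOp_mul_apply, mul_comm, diffOp_mul_apply, diffOp_C] at h
    rw [ih t t.lt_succ_self (by omega) hH
      ((mul_eq_zero.1 h).resolve_left (C_laplaceConst_ne_zero hn t)), mul_zero]

end Powers

/-! ### The apolarity pairing -/

section Duality

variable {k : Type*} [Field k] {n : ℕ}

/-- The linear map `G ↦ G(∂) F`. -/
def contract (F : MvPolynomial (Fin n) k) : MvPolynomial (Fin n) k →ₗ[k] MvPolynomial (Fin n) k :=
  (diffOp k n).toLinearMap.flip F

theorem contract_apply (F G : MvPolynomial (Fin n) k) : contract F G = diffOp k n G F := rfl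

theorem eq_C_of_isHomogeneous_zero {p : MvPolynomial (Fin n) k} (h : p.IsHomogeneous 0) :
    p = C (constantCoeff p) := by
  rw [← totalDegree_zero_iff_isHomogeneous, totalDegree_eq_zero_iff_eq_C] at h
  exact h

/-- The apolarity pairing on forms of degree `d`. -/
def apolarPairing (k : Type*) [Field k] (n d : ℕ) :
    homogeneousSubmodule (Fin n) k d →ₗ[k] Module.Dual k (homogeneousSubmodule (Fin n) k d) :=
  LinearMap.mk₂ k (fun G F => constantCoeff (diffOp k n G.1 F.1))
    (fun _ _ _ => by simp) (fun _ _ _ => by simp [smul_eq_C_mul])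
    (fun _ _ _ => by simp) (fun _ _ _ => by simp)

theorem diffOp_eq_apolarPairing [CharZero k] {d : ℕ} (G F : homogeneousSubmodule (Fin n) k d) :
    diffOp k n G.1 F.1 = C (apolarPairing k n d G F) :=
  eq_C_of_isHomogeneous_zero (diffOp_isHomogeneous G.2 F.2)

theorem apolarPairing_flip_surjective [CharZero k] (d : ℕ) :
    Function.Surjective (apolarPairing k n d).flip := by
  rw [← LinearMap.injective_iff_surjective_of_finrank_eq_finrank
    (Subspace.dual_finrank_eq (K := k)).symm, ← LinearMap.ker_eq_bot, LinearMap.ker_eq_bot']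
  intro F hF
  refine Subtype.ext (eq_zero_of_diffOp_eq_zero F.2 fun G hG => ?_)
  have h : apolarPairing k n d ⟨G, hG⟩ F = 0 := LinearMap.congr_fun hF ⟨G, hG⟩
  have := diffOp_eq_apolarPairing ⟨G, hG⟩ F
  rwa [h, C_0] at this

theorem apolarPairing_surjective [CharZero k] (d : ℕ) :
    Function.Surjective (apolarPairing k n d) := by
  rw [← LinearMap.injective_iff_surjective_of_finrank_eq_finrank
    (Subspace.dual_finrank_eq (K := k)).symm, ← LinearMap.ker_eq_bot, LinearMap.ker_eq_bot']
  intro G hG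
  refine (Module.forall_dual_apply_eq_zero_iff k G).1 fun φ => ?_
  obtain ⟨F, rfl⟩ := apolarPairing_flip_surjective d φ
  exact LinearMap.congr_fun hG F

/-- The pairing is perfect, so functionals on forms of degree d are contractions; separating
functionals can thus be replaced by forms. -/
theorem exists_diffOp_right_eq [CharZero k] (d : ℕ) (φ : Module.Dual k (MvPolynomial (Fin n) k)) :
    ∃ F : MvPolynomial (Fin n) k, F.IsHomogeneous d ∧
      ∀ G : MvPolynomial (Fin n) k, G.IsHomogeneous d → diffOp k n G F = C (φ G) := by
  obtain ⟨F, hF⟩ := apolarPairing_flip_surjective d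
    (φ ∘ₗ (homogeneousSubmodule (Fin n) k d).subtype)
  refine ⟨F.1, F.2, fun G hG => ?_⟩
  rw [diffOp_eq_apolarPairing ⟨G, hG⟩ F]
  exact congrArg C (LinearMap.congr_fun hF ⟨G, hG⟩)

theorem exists_diffOp_left_eq [CharZero k] (d : ℕ) (φ : Module.Dual k (MvPolynomial (Fin n) k)) :
    ∃ G : MvPolynomial (Fin n) k, G.IsHomogeneous d ∧
      ∀ F : MvPolynomial (Fin n) k, F.IsHomogeneous d → diffOp k n G F = C (φ F) := by
  obtain ⟨G, hG⟩ := apolarPairing_surjective d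
    (φ ∘ₗ (homogeneousSubmodule (Fin n) k d).subtype)
  refine ⟨G.1, G.2, fun F hF => ?_⟩
  rw [diffOp_eq_apolarPairing G ⟨F, hF⟩]
  exact congrArg C (LinearMap.congr_fun hG ⟨F, hF⟩)

theorem finrank_map_eq_of_ker_eq {V W W' : Type*} [AddCommGroup V] [Module k V] [AddCommGroup W]
    [Module k W] [AddCommGroup W'] [Module k W'] (p : Submodule k V) [Module.Finite k p]
    (f : V →ₗ[k] W) (g : V →ₗ[k] W') (h : ∀ x ∈ p, f x = 0 ↔ g x = 0) :
    Module.finrank k (p.map f) = Module.finrank k (p.map g) := by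
  have hf := (f.domRestrict p).finrank_range_add_finrank_ker
  have hg := (g.domRestrict p).finrank_range_add_finrank_ker
  have hk : LinearMap.ker (f.domRestrict p) = LinearMap.ker (g.domRestrict p) := by
    ext x
    simpa using h x.1 x.2
  rw [LinearMap.range_domRestrict] at hf hg
  rw [hk] at hf
  omega

theorem hilbertFn_perp (F : MvPolynomial (Fin n) k) (i : ℕ) :
    hilbertFn (perp F) i =
      Module.finrank k ((homogeneousSubmodule (Fin n) k i).map (contract F)) :=
  finrank_map_eq_of_ker_eq _ _ _ fun G _ => by
    rw [contract_apply, ← mem_perp]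
    exact Ideal.Quotient.eq_zero_iff_mem

end Duality

/-! ### Gorenstein quotients: annihilators of forms and the socle pairing -/

section GorensteinPerp

attribute [local instance] MvPolynomial.gradedAlgebra

variable {k : Type*} [Field k] {n : ℕ}

theorem decompose_eq_homogeneousComponent (p : MvPolynomial (Fin n) k) (i : ℕ) :
    (DirectSum.decompose (homogeneousSubmodule (Fin n) k) p i : MvPolynomial (Fin n) k) =
      homogeneousComponent i p :=
  decomposition.decompose'_apply p i

theorem isHomogeneous_iff_homogeneousComponent_mem (I : Ideal (MvPolynomial (Fin n) k)) :
    I.IsHomogeneous (homogeneousSubmodule (Fin n) k) ↔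
      ∀ i, ∀ p ∈ I, homogeneousComponent i p ∈ I := by
  constructor
  · intro h i p hp
    rw [← decompose_eq_homogeneousComponent]
    exact h i hp
  · intro h i p hp
    rw [decompose_eq_homogeneousComponent]
    exact h i p hp

theorem gradedPiece_eq_bot_iff {I : Ideal (MvPolynomial (Fin n) k)} {i : ℕ} :
    gradedPiece I i = ⊥ ↔ ∀ G : MvPolynomial (Fin n) k, G.IsHomogeneous i → G ∈ I := by
  rw [gradedPiece, eq_bot_iff, Submodule.map_le_iff_le_comap]
  exact ⟨fun h G hG => Ideal.Quotient.eq_zero_iff_mem.1 (h hG),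
    fun h G hG => Ideal.Quotient.eq_zero_iff_mem.2 (h G hG)⟩

theorem mem_socle_mk {I : Ideal (MvPolynomial (Fin n) k)} {G : MvPolynomial (Fin n) k} :
    Ideal.Quotient.mk I G ∈ socle I ↔ ∀ i, X i * G ∈ I := by
  simp only [socle, Submodule.mem_iInf, LinearMap.mem_ker, LinearMap.mulLeft_apply, ← map_mul,
    Ideal.Quotient.eq_zero_iff_mem]

theorem mem_gradedPiece_mk {I : Ideal (MvPolynomial (Fin n) k)} {G : MvPolynomial (Fin n) k}
    {i : ℕ} (hG : G.IsHomogeneous i) : Ideal.Quotient.mk I G ∈ gradedPiece I i :=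
  ⟨G, hG, rfl⟩

theorem gradedPiece_eq_bot_of_lt {I : Ideal (MvPolynomial (Fin n) k)} {i j : ℕ}
    (hI : HasSocleDegree I j) (hij : j < i) : gradedPiece I i = ⊥ := by
  by_contra h
  exact absurd (hI.2 h) (not_le.2 hij)

theorem gradedPiece_le_socle {I : Ideal (MvPolynomial (Fin n) k)} {j : ℕ}
    (hI : gradedPiece I (j + 1) = ⊥) : gradedPiece I j ≤ socle I := by
  rintro _ ⟨G, hG, rfl⟩
  refine mem_socle_mk.2 fun i => gradedPiece_eq_bot_iff.1 hI _ ?_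
  rw [add_comm]
  exact (isHomogeneous_X k i).mul hG

theorem mk_eq_sum_homogeneousComponent (I : Ideal (MvPolynomial (Fin n) k))
    (G : MvPolynomial (Fin n) k) :
    Ideal.Quotient.mk I G =
      ∑ i ∈ Finset.range (G.totalDegree + 1), Ideal.Quotient.mk I (homogeneousComponent i G) := by
  rw [← map_sum, sum_homogeneousComponent]

/-- Components of G of different degrees m ≤ j send F to different degrees j - m, so no cancellation
occurs between them; those with m > j kill F outright. -/
theorem perp_isHomogeneous [CharZero k] {F : MvPolynomial (Fin n) k} {j : ℕ}
    (hF : F.IsHomogeneous j) : (perp F).IsHomogeneous (homogeneousSubmodule (Fin n) k) := by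
  rw [isHomogeneous_iff_homogeneousComponent_mem]
  intro i G hG
  rw [mem_perp] at hG ⊢
  rcases lt_or_ge j i with hij | hij
  · exact diffOp_eq_zero_of_lt (homogeneousComponent_isHomogeneous i G) hF hij
  have hhom : ∀ m ≤ j, (diffOp k n (homogeneousComponent m G) F).IsHomogeneous (j - m) :=
    fun m hm => diffOp_isHomogeneous (homogeneousComponent_isHomogeneous m G)
      (by rwa [Nat.add_sub_of_le hm])
  have h := congrArg (homogeneousComponent (j - i)) hG
  rw [← sum_homogeneousComponent G, diffOp_sum_apply, map_sum, map_zero] at h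
  have hterm : ∀ m, homogeneousComponent (j - i) (diffOp k n (homogeneousComponent m G) F) =
      if m = i then diffOp k n (homogeneousComponent i G) F else 0 := by
    intro m
    rcases lt_or_ge j m with hm | hm
    · rw [diffOp_eq_zero_of_lt (homogeneousComponent_isHomogeneous m G) hF hm, map_zero,
        if_neg (by omega)]
    · rw [homogeneousComponent_of_mem (hhom m hm)]
      by_cases hmi : m = i
      · subst hmi
        simp
      · rw [if_neg (by omega), if_neg hmi]
  simp only [hterm, Finset.sum_ite_eq', Finset.mem_range] at h
  by_cases hi : i < G.totalDegree + 1
  · rwa [if_pos hi] at h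
  · rw [homogeneousComponent_eq_zero i G (by omega), map_zero, LinearMap.zero_apply]

theorem gradedPiece_perp_eq_bot [CharZero k] {F : MvPolynomial (Fin n) k} {i j : ℕ}
    (hF : F.IsHomogeneous j) (hij : j < i) : gradedPiece (perp F) i = ⊥ :=
  gradedPiece_eq_bot_iff.2 fun _ hG => diffOp_eq_zero_of_lt hG hF hij

theorem perp_hasSocleDegree [CharZero k] {F : MvPolynomial (Fin n) k} {j : ℕ}
    (hF : F.IsHomogeneous j) (hF0 : F ≠ 0) : HasSocleDegree (perp F) j := by
  refine ⟨fun h => hF0 (eq_zero_of_diffOp_eq_zero hF (gradedPiece_eq_bot_iff.1 h)), fun i hi => ?_⟩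
  by_contra hij
  exact hi (gradedPiece_perp_eq_bot hF (not_le.1 hij))

/-- If G of degree m < j represents a socle element, all partials of the form G(∂)F of positive
degree j - m vanish, and Euler's identity makes it zero. -/
theorem socle_perp [CharZero k] {F : MvPolynomial (Fin n) k} {j : ℕ} (hF : F.IsHomogeneous j) :
    socle (perp F) = gradedPiece (perp F) j := by
  refine le_antisymm (fun g hg => ?_) (gradedPiece_le_socle (gradedPiece_perp_eq_bot hF
    j.lt_succ_self))
  obtain ⟨G, rfl⟩ := Ideal.Quotient.mk_surjective g
  rw [mem_socle_mk] at hg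
  rw [mk_eq_sum_homogeneousComponent]
  refine Submodule.sum_mem _ fun m _ => ?_
  have hm := homogeneousComponent_isHomogeneous m G
  rcases lt_trichotomy m j with hmj | rfl | hmj
  · have hhom : (diffOp k n (homogeneousComponent m G) F).IsHomogeneous (j - m) :=
      diffOp_isHomogeneous hm (by rwa [Nat.add_sub_of_le hmj.le])
    have hE := hhom.sum_X_mul_pderiv
    have hz : ∀ i, pderiv i (diffOp k n (homogeneousComponent m G) F) = 0 := fun i => by
      rw [← diffOp_X_apply, ← diffOp_mul_apply, ← mem_perp]
      have := (isHomogeneous_iff_homogeneousComponent_mem _).1 (perp_isHomogeneous hF) (m + 1) _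
        (hg i)
      rw [← decompose_eq_homogeneousComponent, DirectSum.coe_decompose_mul_of_left_mem_of_le _
        (isHomogeneous_X k i) (by omega : 1 ≤ m + 1), decompose_eq_homogeneousComponent,
        Nat.add_sub_cancel] at this
      exact this
    simp only [hz, mul_zero, Finset.sum_const_zero] at hE
    have h0 : diffOp k n (homogeneousComponent m G) F = 0 := by
      rw [eq_comm, ← Nat.cast_smul_eq_nsmul k, smul_eq_zero] at hE
      exact hE.resolve_left (Nat.cast_ne_zero.2 (by omega))
    rw [Ideal.Quotient.eq_zero_iff_mem.2 (mem_perp.2 h0)]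
    exact Submodule.zero_mem _
  · exact mem_gradedPiece_mk hm
  · rw [Ideal.Quotient.eq_zero_iff_mem.2 (mem_perp.2 (diffOp_eq_zero_of_lt hm hF hmj))]
    exact Submodule.zero_mem _

instance finite_gradedPiece (I : Ideal (MvPolynomial (Fin n) k)) (i : ℕ) :
    Module.Finite k (gradedPiece I i) :=
  Module.Finite.map _ _

theorem perp_isArtinianGorenstein [CharZero k] {F : MvPolynomial (Fin n) k} {j : ℕ}
    (hF : F.IsHomogeneous j) (hF0 : F ≠ 0) : IsArtinianGorenstein (perp F) where
  homogeneous := perp_isHomogeneous hF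
  artinian := by
    have htop : (⨆ i : Fin (j + 1), gradedPiece (perp F) i) = ⊤ := by
      rw [eq_top_iff]
      rintro g -
      obtain ⟨G, rfl⟩ := Ideal.Quotient.mk_surjective g
      rw [mk_eq_sum_homogeneousComponent]
      refine Submodule.sum_mem _ fun m _ => ?_
      have hm := homogeneousComponent_isHomogeneous m G
      rcases lt_or_ge j m with hmj | hmj
      · rw [Ideal.Quotient.eq_zero_iff_mem.2 (mem_perp.2 (diffOp_eq_zero_of_lt hm hF hmj))]
        exact Submodule.zero_mem _
      · exact Submodule.mem_iSup_of_mem (⟨m, by omega⟩ : Fin (j + 1)) (mem_gradedPiece_mk hm)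
    have hfin : Module.Finite k (MvPolynomial (Fin n) k ⧸ perp F) := by
      rw [Module.finite_def, ← htop]
      refine Submodule.fg_iSup _ fun i => ?_
      exact (homogeneousSubmodule_fg (Fin n) k _).map _
    exact IsArtinianRing.of_finite k _
  socle_dim := by
    rw [socle_perp hF]
    have hle : (homogeneousSubmodule (Fin n) k j).map (contract F) ≤
        homogeneousSubmodule (Fin n) k 0 := by
      rintro _ ⟨G, hG, rfl⟩
      exact (diffOp_isHomogeneous (e := 0) hG hF : (diffOp k n G F).IsHomogeneous 0)
    have h1 : hilbertFn (perp F) j ≤ 1 := by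
      rw [hilbertFn_perp]
      refine (Submodule.finrank_mono hle).trans ?_
      rw [finrank_homogeneousSubmodule, Nat.multichoose_zero_right]
    have h2 : hilbertFn (perp F) j ≠ 0 := fun h =>
      (perp_hasSocleDegree hF hF0).1 (Submodule.finrank_eq_zero.1 h)
    exact le_antisymm h1 (Nat.one_le_iff_ne_zero.2 h2)

/-- In a graded artinian Gorenstein algebra of socle degree `j`, multiplication by forms of the
complementary degree detects non-zero forms. -/
theorem mem_of_mul_mem {I : Ideal (MvPolynomial (Fin n) k)} {j : ℕ}
    (hI : IsArtinianGorenstein I) (hj : HasSocleDegree I j) {i e : ℕ} (hie : i + e = j)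
    {G : MvPolynomial (Fin n) k} (hG : G.IsHomogeneous i)
    (h : ∀ H : MvPolynomial (Fin n) k, H.IsHomogeneous e → H * G ∈ I) : G ∈ I := by
  induction e generalizing i G with
  | zero => simpa using h 1 (isHomogeneous_one _ _)
  | succ e ih =>
    have hX : ∀ l, X l * G ∈ I := fun l => by
      refine ih (i := i + 1) (by omega) (by
        rw [add_comm]; exact (isHomogeneous_X k l).mul hG) fun H hH => ?_
      rw [← mul_assoc]
      exact h _ (hH.mul (isHomogeneous_X k l))
    have hs : Ideal.Quotient.mk I G ∈ gradedPiece I j := by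
      have hle := gradedPiece_le_socle (gradedPiece_eq_bot_of_lt hj j.lt_succ_self)
      have : Module.Finite k (socle I) := Module.finite_of_finrank_pos (by rw [hI.socle_dim]; omega)
      -- The non-zero piece of degree j lies in the one-dimensional socle, so it is the whole socle.
      rw [Submodule.eq_of_le_of_finrank_le hle]
      · exact mem_socle_mk.2 hX
      · rw [hI.socle_dim, Nat.one_le_iff_ne_zero]
        exact fun h => hj.1 (Submodule.finrank_eq_zero.1 h)
    obtain ⟨G', hG', hGG'⟩ := hs
    have hsub : G' - G ∈ I := Ideal.Quotient.eq.1 hGG'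
    -- G is congruent to a form of degree j ≠ i, so its own component, in degree i, must lie in I.
    have hc := (isHomogeneous_iff_homogeneousComponent_mem _).1 hI.homogeneous i _ hsub
    rw [map_sub, homogeneousComponent_of_mem hG', homogeneousComponent_of_mem hG, if_pos rfl,
      if_neg (by omega), zero_sub, neg_mem_iff] at hc
    exact hc

theorem hilbertFn_le_multichoose (I : Ideal (MvPolynomial (Fin n) k)) (i : ℕ) :
    hilbertFn I i ≤ n.multichoose i := by
  rw [← finrank_homogeneousSubmodule k]
  exact Submodule.finrank_map_le _ _

/-- A functional ψ that is non-zero on the socle gives the pairing (G, H) ↦ ψ(GH) in degrees i and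
e. Its left kernel is I in degree i, so that piece of R/I embeds in the dual of the forms of degree
e. -/
theorem hilbertFn_le_multichoose_sub {I : Ideal (MvPolynomial (Fin n) k)} {j : ℕ}
    (hI : IsArtinianGorenstein I) (hj : HasSocleDegree I j) {i e : ℕ} (hie : i + e = j) :
    hilbertFn I i ≤ n.multichoose e := by
  obtain ⟨s, hs0, hs⟩ := finrank_eq_one_iff'.1 hI.socle_dim
  obtain ⟨ψ, hψ⟩ : ∃ ψ : Module.Dual k (MvPolynomial (Fin n) k ⧸ I), ψ s.1 ≠ 0 := by
    by_contra! h
    exact hs0 (Subtype.ext ((Module.forall_dual_apply_eq_zero_iff k s.1).1 h))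
  have hψ0 : ∀ g ∈ socle I, ψ g = 0 → g = 0 := fun g hg h => by
    obtain ⟨c, hc⟩ := hs ⟨g, hg⟩
    have hc' : c • s.1 = g := congrArg Subtype.val hc
    rw [← hc', map_smul, smul_eq_mul] at h
    rw [← hc', (mul_eq_zero.1 h).resolve_right hψ, zero_smul]
  have hle := gradedPiece_le_socle (gradedPiece_eq_bot_of_lt hj j.lt_succ_self)
  let Φ : MvPolynomial (Fin n) k →ₗ[k] Module.Dual k (homogeneousSubmodule (Fin n) k e) :=
    (homogeneousSubmodule (Fin n) k e).subtype.dualMap ∘ₗ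
      (LinearMap.mul k (MvPolynomial (Fin n) k)).compr₂ (ψ ∘ₗ (Ideal.Quotient.mkₐ k I).toLinearMap)
  have hΦ : ∀ G (H : homogeneousSubmodule (Fin n) k e),
      Φ G H = ψ (Ideal.Quotient.mk I (G * H.1)) := fun _ _ => rfl
  calc hilbertFn I i = Module.finrank k ((homogeneousSubmodule (Fin n) k i).map Φ) := by
        refine finrank_map_eq_of_ker_eq _ _ _ fun G hG => ?_
        rw [show (Ideal.Quotient.mkₐ k I).toLinearMap G = 0 ↔ G ∈ I from
          Ideal.Quotient.eq_zero_iff_mem]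
        constructor
        · intro h
          refine LinearMap.ext fun H => ?_
          rw [hΦ, Ideal.Quotient.eq_zero_iff_mem.2 (I.mul_mem_right _ h), map_zero]
          rfl
        · intro h
          refine mem_of_mul_mem hI hj hie hG fun H hH => ?_
          rw [mul_comm, ← Ideal.Quotient.eq_zero_iff_mem]
          refine hψ0 _ (hle (mem_gradedPiece_mk ?_)) (LinearMap.congr_fun h ⟨H, hH⟩)
          rw [← hie]
          exact IsHomogeneous.mul hG hH
    _ ≤ Module.finrank k (Module.Dual k (homogeneousSubmodule (Fin n) k e)) :=
        Submodule.finrank_le _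
    _ = n.multichoose e := by rw [Subspace.dual_finrank_eq, finrank_homogeneousSubmodule]

end GorensteinPerp

/-! ### Hilbert function of the annihilator of Q^t -/

section Compressed

attribute [local instance] MvPolynomial.gradedAlgebra

variable {k : Type*} [Field k] {n : ℕ}

theorem pow_ne_zero_of_hessian [CharZero k] (hn : 0 < n) {Q : MvPolynomial (Fin n) k}
    (hQ : Q.IsHomogeneous 2) (hdet : IsUnit (hessian Q).det) (t : ℕ) : Q ^ t ≠ 0 := fun h =>
  one_ne_zero (eq_zero_of_diffOp_pow_eq_zero hn hQ hdet t.zero_le (isHomogeneous_one _ _)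
    (by rw [h, map_zero]))

theorem finrank_map_eq_of_injOn {V W : Type*} [AddCommGroup V] [Module k V] [AddCommGroup W]
    [Module k W] (p : Submodule k V) [Module.Finite k p] (f : V →ₗ[k] W)
    (h : ∀ x ∈ p, f x = 0 → x = 0) :
    Module.finrank k (p.map f) = Module.finrank k p := by
  rw [finrank_map_eq_of_ker_eq p f LinearMap.id fun x hx => ⟨h x hx, fun h0 => by
    rw [show x = 0 from h0, map_zero]⟩, Submodule.map_id]

/-- The derivatives of order `e` of `Q ^ (m + e)` are exactly the multiples of `Q ^ m`. -/
theorem exists_diffOp_pow_eq_pow_mul [CharZero k] (hn : 0 < n) {Q : MvPolynomial (Fin n) k}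
    (hQ : Q.IsHomogeneous 2) (hdet : IsUnit (hessian Q).det) (m e : ℕ)
    {H : MvPolynomial (Fin n) k} (hH : H.IsHomogeneous e) :
    ∃ K : MvPolynomial (Fin n) k, K.IsHomogeneous e ∧ diffOp k n K (Q ^ (m + e)) = Q ^ m * H := by
  have hle : (homogeneousSubmodule (Fin n) k e).map (contract (Q ^ (m + e))) ≤
      (homogeneousSubmodule (Fin n) k e).map (LinearMap.mulLeft k (Q ^ m)) := by
    rintro _ ⟨K, hK, rfl⟩
    have hdvd := pow_dvd_diffOp Q m (show K.IsHomogeneous e from hK) 1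
    have hhom : (diffOp k n K (Q ^ (m + e))).IsHomogeneous (2 * m + e) :=
      diffOp_isHomogeneous hK (by
        have := hQ.pow (m + e)
        rwa [show 2 * (m + e) = e + (2 * m + e) by ring] at this)
    rw [mul_one] at hdvd
    rcases exists_isHomogeneous_of_dvd (hQ.pow m) hhom hdvd with h0 | ⟨_, P, hP, hPK⟩
    · exact ⟨0, Submodule.zero_mem _, by rw [map_zero]; exact h0.symm⟩
    · rw [Nat.add_sub_cancel_left] at hP
      exact ⟨P, hP, hPK.symm⟩
  -- Both maps are injective on forms of degree e, so the two images have the same dimension.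
  have heq := Submodule.eq_of_le_of_finrank_eq hle (by
    rw [finrank_map_eq_of_injOn, finrank_map_eq_of_injOn]
    · exact fun P _ h => (mul_eq_zero.1 h).resolve_left (pow_ne_zero_of_hessian hn hQ hdet m)
    · exact fun K hK h => eq_zero_of_diffOp_pow_eq_zero hn hQ hdet (Nat.le_add_left e m) hK h)
  have hmem : Q ^ m * H ∈ (homogeneousSubmodule (Fin n) k e).map
      (LinearMap.mulLeft k (Q ^ m)) := ⟨H, hH, rfl⟩
  rw [← heq] at hmem
  exact hmem

/-- A functional vanishing on the image is contraction with some H of degree e ≤ t; then H kills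
Q^t, hence H = 0. -/
theorem map_contract_pow_eq [CharZero k] (hn : 0 < n) {Q : MvPolynomial (Fin n) k}
    (hQ : Q.IsHomogeneous 2) (hdet : IsUnit (hessian Q).det) {t i e : ℕ} (hie : i + e = 2 * t)
    (het : e ≤ t) : (homogeneousSubmodule (Fin n) k i).map (contract (Q ^ t)) =
      homogeneousSubmodule (Fin n) k e := by
  have hQt : (Q ^ t).IsHomogeneous (i + e) := hie ▸ hQ.pow t
  refine le_antisymm ?_ fun P hP => ?_
  · rintro _ ⟨G, hG, rfl⟩
    exact (diffOp_isHomogeneous hG hQt : (diffOp k n G (Q ^ t)).IsHomogeneous e)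
  · by_contra hPn
    obtain ⟨φ, hφP, hφ⟩ := Submodule.exists_le_ker_of_notMem hPn
    obtain ⟨H, hH, hHφ⟩ := exists_diffOp_left_eq e φ
    have hH0 : diffOp k n H (Q ^ t) = 0 := by
      refine eq_zero_of_diffOp_eq_zero (d := i)
        (diffOp_isHomogeneous hH (by rwa [add_comm])) fun G hG => ?_
      rw [← diffOp_mul_apply, mul_comm, diffOp_mul_apply, hHφ _ (diffOp_isHomogeneous hG hQt),
        show φ (diffOp k n G (Q ^ t)) = 0 from hφ ⟨G, hG, rfl⟩, C_0]
    have := hHφ P hP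
    rw [eq_zero_of_diffOp_pow_eq_zero hn hQ hdet het hH hH0, map_zero, LinearMap.zero_apply,
      eq_comm, C_eq_zero] at this
    exact hφP this

theorem hilbertFn_perp_pow_of_le [CharZero k] (hn : 0 < n) {Q : MvPolynomial (Fin n) k}
    (hQ : Q.IsHomogeneous 2) (hdet : IsUnit (hessian Q).det) {t i : ℕ} (hi : i ≤ t) :
    hilbertFn (perp (Q ^ t)) i = n.multichoose i := by
  rw [hilbertFn_perp, finrank_map_eq_of_injOn, finrank_homogeneousSubmodule]
  exact fun K hK h => eq_zero_of_diffOp_pow_eq_zero hn hQ hdet hi hK h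

theorem hilbertFn_perp_pow_of_ge [CharZero k] (hn : 0 < n) {Q : MvPolynomial (Fin n) k}
    (hQ : Q.IsHomogeneous 2) (hdet : IsUnit (hessian Q).det) {t i e : ℕ} (hie : i + e = 2 * t)
    (het : e ≤ t) : hilbertFn (perp (Q ^ t)) i = n.multichoose e := by
  rw [hilbertFn_perp, map_contract_pow_eq hn hQ hdet hie het, finrank_homogeneousSubmodule]

theorem perp_pow_isCompressedGorenstein [CharZero k] (hn : 0 < n) {Q : MvPolynomial (Fin n) k}
    (hQ : Q.IsHomogeneous 2) (hdet : IsUnit (hessian Q).det) (t : ℕ) :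
    IsCompressedGorenstein (perp (Q ^ t)) (2 * t) where
  gorenstein := perp_isArtinianGorenstein (hQ.pow t) (pow_ne_zero_of_hessian hn hQ hdet t)
  socleDegree := perp_hasSocleDegree (hQ.pow t) (pow_ne_zero_of_hessian hn hQ hdet t)
  maximal J hJ hJt i := by
    rcases le_or_gt i t with hi | hi
    · rw [hilbertFn_perp_pow_of_le hn hQ hdet hi]
      exact hilbertFn_le_multichoose J i
    rcases le_or_gt i (2 * t) with hi2 | hi2
    · rw [hilbertFn_perp_pow_of_ge hn hQ hdet (e := 2 * t - i) (by omega) (by omega)]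
      exact hilbertFn_le_multichoose_sub hJ hJt (by omega)
    · rw [hilbertFn, gradedPiece_eq_bot_of_lt hJt hi2, finrank_bot]
      exact Nat.zero_le _

theorem multichoose_four (i : ℕ) : Nat.multichoose 4 i = (i + 3).choose 3 := by
  rw [Nat.multichoose_eq, show 4 + i - 1 = i + 3 by omega, ← Nat.choose_symm_add]

theorem hilbertFn_perp_pow_four [CharZero k] {Q : MvPolynomial (Fin 4) k}
    (hQ : Q.IsHomogeneous 2) (hdet : IsUnit (hessian Q).det) {t i : ℕ} (hi : i ≤ 2 * t) :
    hilbertFn (perp (Q ^ t)) i = min ((i + 3).choose 3) ((2 * t - i + 3).choose 3) := by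
  rcases le_total i t with h | h
  · rw [hilbertFn_perp_pow_of_le four_pos hQ hdet h, multichoose_four,
      min_eq_left (Nat.choose_le_choose 3 (by omega))]
  · rw [hilbertFn_perp_pow_of_ge four_pos hQ hdet (e := 2 * t - i) (by omega) (by omega),
      multichoose_four, min_eq_right (Nat.choose_le_choose 3 (by omega))]

end Compressed

/-! ### Rational points of the quadric and stereographic projection -/

section IsotropicPoints

attribute [local instance] MvPolynomial.gradedAlgebra

variable {k : Type*} [Field k] {n : ℕ}

theorem two_mul_eval {Q : MvPolynomial (Fin n) k} (hQ : Q.IsHomogeneous 2) (v : Fin n → k) :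
    2 * eval v Q = v ⬝ᵥ (hessian Q).mulVec v := by
  have h := congrArg (eval v) hQ.sum_X_mul_pderiv
  simp only [map_sum, map_mul, eval_X, eval_pderiv hQ, nsmul_eq_mul,
    Nat.cast_two, map_ofNat] at h
  exact h.symm

theorem polar_comm (Q : MvPolynomial (Fin n) k) (v w : Fin n → k) :
    v ⬝ᵥ (hessian Q).mulVec w = w ⬝ᵥ (hessian Q).mulVec v := by
  rw [Matrix.dotProduct_mulVec, ← Matrix.mulVec_transpose, hessian_transpose, dotProduct_comm]

theorem eval_add_eq [CharZero k] {Q : MvPolynomial (Fin n) k} (hQ : Q.IsHomogeneous 2)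
    (v w : Fin n → k) :
    eval (v + w) Q = eval v Q + v ⬝ᵥ (hessian Q).mulVec w + eval w Q := by
  refine mul_left_cancel₀ (two_ne_zero (α := k)) ?_
  rw [mul_add, mul_add, two_mul_eval hQ, two_mul_eval hQ, two_mul_eval hQ, Matrix.mulVec_add,
    add_dotProduct, dotProduct_add, dotProduct_add, polar_comm Q w v]
  ring

theorem eval_smul_eq [CharZero k] {Q : MvPolynomial (Fin n) k} (hQ : Q.IsHomogeneous 2) (c : k)
    (v : Fin n → k) : eval (c • v) Q = c ^ 2 * eval v Q := by
  refine mul_left_cancel₀ (two_ne_zero (α := k)) ?_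
  rw [two_mul_eval hQ, mul_left_comm, two_mul_eval hQ, Matrix.mulVec_smul, smul_dotProduct,
    dotProduct_smul, smul_eq_mul, smul_eq_mul]
  ring

theorem mk_mem_points [CharZero k] {Q : MvPolynomial (Fin n) k} (hQ : Q.IsHomogeneous 2)
    {v : Fin n → k} (hv : v ≠ 0) : Projectivization.mk k v hv ∈ points Q ↔ eval v Q = 0 := by
  change (∀ w ∈ (Projectivization.mk k v hv).submodule, eval w Q = 0) ↔ _
  rw [Projectivization.submodule_mk]
  refine ⟨fun h => h v (Submodule.mem_span_singleton_self v), fun h w hw => ?_⟩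
  obtain ⟨c, rfl⟩ := Submodule.mem_span_singleton.1 hw
  rw [eval_smul_eq hQ, h, mul_zero]

/-- Along an isotropic v the second derivative of Q is zero, so each derivative trades a factor Q
for the constant-along-v factor DQ; after t steps no Q is left to differentiate. -/
theorem diffOp_linForm_pow_eq_zero [CharZero k] {Q : MvPolynomial (Fin n) k}
    (hQ : Q.IsHomogeneous 2) {v : Fin n → k} (hv : eval v Q = 0) (t : ℕ) :
    diffOp k n (linForm v ^ (t + 1)) (Q ^ t) = 0 := by
  let D : Derivation k (MvPolynomial (Fin n) k) (MvPolynomial (Fin n) k) :=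
    Derivation.mk' (diffOp k n (linForm v)) fun F G => by
      rw [diffOp_linForm_mul, smul_eq_mul, smul_eq_mul, mul_comm G, add_comm]
  have hD : ∀ F, diffOp k n (linForm v) F = D F := fun _ => rfl
  have hDD : D (D Q) = 0 := by
    rw [← hD, ← hD, ← diffOp_mul_apply, ← sq, diffOp_linForm_pow v hQ, hv, mul_zero, C_0]
  suffices h : ∀ m, diffOp k n (linForm v ^ (t + 1)) (Q ^ t * D Q ^ m) = 0 by simpa using h 0
  induction t with
  | zero => intro m; simp [hD, Derivation.leibniz_pow, hDD]
  | succ t ih =>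
    intro m
    have : diffOp k n (linForm v) (Q ^ (t + 1) * D Q ^ m) =
        C ((t + 1 : ℕ) : k) * (Q ^ t * D Q ^ (m + 1)) := by
      rw [hD, Derivation.leibniz, Derivation.leibniz_pow, Derivation.leibniz_pow, hDD]
      simp only [smul_eq_mul, nsmul_eq_mul, map_natCast, Nat.add_sub_cancel]
      ring
    rw [pow_succ, diffOp_mul_apply, this, ← diffOp_C, ← diffOp_mul_apply, mul_comm,
      diffOp_mul_apply, ih, map_zero]

theorem exists_eq_linForm {F : MvPolynomial (Fin n) k} (hF : F.IsHomogeneous 1) :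
    ∃ v, F = linForm v := by
  have h := hF.sum_X_mul_pderiv
  rw [one_smul] at h
  refine ⟨fun i => constantCoeff (pderiv i F), ?_⟩
  rw [← h, linForm]
  refine Finset.sum_congr rfl fun i _ => ?_
  rw [h, ← eq_C_of_isHomogeneous_zero hF.pderiv, mul_comm]

theorem linForm_prime {v : Fin n → k} (hv : v ≠ 0) : Prime (linForm v) := by
  have h0 : linForm v ≠ 0 := linForm_eq_zero.not.2 hv
  refine (irreducible_of_totalDegree_eq_one ((linForm_isHomogeneous v).totalDegree h0)
    fun x hx => isUnit_iff_ne_zero.2 ?_).prime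
  rintro rfl
  exact h0 (ext _ _ fun m => by simpa using hx m)

/-- A product of two linear forms in more than two variables is singular at any common zero of both.
-/
theorem not_linForm_dvd [CharZero k] (hn : 2 < n) {Q : MvPolynomial (Fin n) k}
    (hQ : Q.IsHomogeneous 2) (hQ0 : Q ≠ 0)
    (hgrad : ∀ v : Fin n → k, (∀ i, eval v (pderiv i Q) = 0) → v = 0)
    (u : Fin n → k) : ¬ linForm u ∣ Q := by
  intro h
  rcases exists_isHomogeneous_of_dvd (linForm_isHomogeneous u) hQ h with h0 | ⟨-, H, hH, rfl⟩
  · exact hQ0 h0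
  obtain ⟨w, rfl⟩ := exists_eq_linForm hH
  have hker : LinearMap.ker (Matrix.mulVecLin (Matrix.of ![u, w])) ≠ ⊥ :=
    LinearMap.ker_ne_bot_of_finrank_lt (by simpa using hn)
  obtain ⟨x, hx, hx0⟩ := Submodule.exists_mem_ne_zero_of_ne_bot hker
  have hu : u ⬝ᵥ x = 0 := congrFun hx 0
  have hw : w ⬝ᵥ x = 0 := congrFun hx 1
  refine hx0 (hgrad x fun i => ?_)
  rw [Derivation.leibniz]
  simp [eval_linForm, hu, hw]

theorem dvd_of_dvd_prime_pow_mul {R : Type*} [CommRing R] [IsDomain R] {p q x : R} (hp : Prime p)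
    (hpq : ¬ p ∣ q) {e : ℕ} (h : q ∣ p ^ e * x) : q ∣ x := by
  induction e with
  | zero => simpa using h
  | succ e ih =>
    refine ih ?_
    obtain ⟨y, hy⟩ := h
    obtain ⟨z, rfl⟩ := (hp.dvd_or_dvd (show p ∣ q * y from ⟨p ^ e * x, by rw [← hy]; ring⟩)
      ).resolve_left hpq
    exact ⟨z, mul_left_cancel₀ hp.ne_zero (by linear_combination hy)⟩

theorem aeval_mul_X [CharZero k] {e : ℕ} {F : MvPolynomial (Fin n) k} (hF : F.IsHomogeneous e)
    (c : MvPolynomial (Fin n) k) : aeval (fun i => c * X i) F = c ^ e * F := by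
  refine homogeneous_induction (P := fun e F => aeval (fun i => c * X i) F = c ^ e * F)
    ?_ ?_ ?_ ?_ hF
  · intro a
    simp [algebraMap_eq]
  · intro e G H hG hH
    rw [map_add, hG, hH, mul_add]
  · intro e
    simp
  · intro e j a G _ hG
    rw [map_mul, hG, map_mul, aeval_C, aeval_X, algebraMap_eq]
    ring

theorem dvd_aeval_sub_aeval {Q : MvPolynomial (Fin n) k} {f g : Fin n → MvPolynomial (Fin n) k}
    (h : ∀ i, Q ∣ f i - g i) (F : MvPolynomial (Fin n) k) : Q ∣ aeval f F - aeval g F := by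
  rw [← Ideal.mem_span_singleton, ← Ideal.Quotient.eq]
  have : (Ideal.Quotient.mkₐ k (Ideal.span {Q})).comp (aeval f) =
      (Ideal.Quotient.mkₐ k (Ideal.span {Q})).comp (aeval g) := by
    refine algHom_ext fun i => ?_
    simp only [AlgHom.comp_apply, aeval_X]
    exact Ideal.Quotient.eq.2 (Ideal.mem_span_singleton.2 (h i))
  exact DFunLike.congr_fun this F

theorem eval_aeval (w : Fin n → k) (f : Fin n → MvPolynomial (Fin n) k)
    (F : MvPolynomial (Fin n) k) : eval w (aeval f F) = eval (fun i => eval w (f i)) F := by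
  have : (aeval w : MvPolynomial (Fin n) k →ₐ[k] k).comp (aeval f) =
      aeval fun i => eval w (f i) := algHom_ext fun i => by
    simp
  exact DFunLike.congr_fun this F

/-- A form vanishing at all rational points of a smooth quadric that has a rational point is
divisible by the equation of the quadric. -/
theorem dvd_of_forall_eval_eq_zero [CharZero k] (hn : 2 < n) {Q : MvPolynomial (Fin n) k}
    (hQ : Q.IsHomogeneous 2) (hdet : IsUnit (hessian Q).det) {p : Fin n → k} (hp0 : p ≠ 0)
    (hp : eval p Q = 0) {e : ℕ} {F : MvPolynomial (Fin n) k} (hF : F.IsHomogeneous e)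
    (h : ∀ v ≠ 0, eval v Q = 0 → eval v F = 0) : Q ∣ F := by
  have hmulVec : ∀ v, (hessian Q).mulVec v = 0 → v = 0 := fun v hv =>
    Matrix.mulVec_injective_of_isUnit ((Matrix.isUnit_iff_isUnit_det _).2 hdet)
      (by rw [hv, Matrix.mulVec_zero])
  rcases Nat.eq_zero_or_pos e with rfl | he
  · have hp' := h p hp0 hp
    rw [eq_C_of_isHomogeneous_zero hF, eval_C] at hp'
    rw [eq_C_of_isHomogeneous_zero hF, hp', C_0]
    exact dvd_zero _
  have h0 : eval 0 F = 0 := by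
    have h1 := eval_diffOp_linForm 0 hF
    rw [linForm_eq_zero.2 rfl, map_zero, LinearMap.zero_apply, map_zero, eq_comm] at h1
    exact (mul_eq_zero.1 h1).resolve_left (Nat.cast_ne_zero.2 he.ne')
  set l := linForm ((hessian Q).mulVec p) with hl
  -- Stereographic projection from p: w ↦ Q(w)p - l(w)w always lands on the quadric, so F composed
  -- with it vanishes identically.
  have hsub : aeval (fun i => Q * C (p i) + -l * X i) F = 0 := by
    refine funext fun w => ?_
    have hw : eval w (aeval (fun i => Q * C (p i) + -l * X i) F) =
        eval (eval w Q • p + (-eval w l) • w) F := by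
      rw [eval_aeval]
      congr 2
      funext i
      simp
    rw [hw, map_zero]
    by_cases hv : eval w Q • p + (-eval w l) • w = 0
    · rw [hv, h0]
    · refine h _ hv ?_
      rw [eval_add_eq hQ, eval_smul_eq hQ, eval_smul_eq hQ, hp, Matrix.mulVec_smul,
        smul_dotProduct, dotProduct_smul, polar_comm, dotProduct_comm, hl, eval_linForm]
      simp only [smul_eq_mul]
      ring
  -- Modulo Q the projection is w ↦ -l(w)w, so Q divides l^e F; the prime l does not divide Q and
  -- cancels.
  have hd := dvd_aeval_sub_aeval (Q := Q) (f := fun i => Q * C (p i) + -l * X i)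
    (g := fun i => -l * X i) (fun i => ⟨C (p i), by ring⟩) F
  rw [hsub, aeval_mul_X hF, zero_sub, dvd_neg, neg_pow, mul_assoc,
    (IsUnit.neg isUnit_one |>.pow e).dvd_mul_left] at hd
  refine dvd_of_dvd_prime_pow_mul (linForm_prime fun h => hp0 (hmulVec p h))
    (not_linForm_dvd hn hQ ?_ ?_ _) hd
  · simpa using pow_ne_zero_of_hessian (by omega) hQ hdet 1
  · exact fun v hv => hmulVec v (_root_.funext fun i => by rw [← eval_pderiv hQ, hv]; rfl)

end IsotropicPoints

/-! ### The annihilator is generated by powers dual to rational points -/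

section PowerIdeal

variable {k : Type*} [Field k] {n : ℕ}

theorem linForm_pow_mem_powerIdeal {Y : Set (ℙ k (Fin n → k))} {d : ℕ} {v : Fin n → k}
    (hv : v ≠ 0) (h : Projectivization.mk k v hv ∈ Y) : linForm v ^ d ∈ powerIdeal Y d :=
  Ideal.subset_span ⟨v, hv, h, rfl⟩

theorem powerIdeal_mono {Y Z : Set (ℙ k (Fin n → k))} (h : Y ⊆ Z) (d : ℕ) :
    powerIdeal Y d ≤ powerIdeal Z d :=
  Ideal.span_mono fun _ ⟨v, hv, hY, hG⟩ => ⟨v, hv, h hY, hG⟩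

/-- A form of degree `d` apolar to all the powers `ℓ ^ (t + 1)` with `ℓ` dual to a point of a smooth
quadric vanishes on the quadric to order `d - t`. -/
theorem pow_dvd_of_apolar [CharZero k] (hn : 2 < n) {Q : MvPolynomial (Fin n) k}
    (hQ : Q.IsHomogeneous 2) (hdet : IsUnit (hessian Q).det) {p : Fin n → k} (hp0 : p ≠ 0)
    (hp : eval p Q = 0) {t d : ℕ} {F : MvPolynomial (Fin n) k} (hF : F.IsHomogeneous d)
    (h : ∀ v ≠ 0, eval v Q = 0 → ∀ H : MvPolynomial (Fin n) k,
      (H * linForm v ^ (t + 1)).IsHomogeneous d → diffOp k n (H * linForm v ^ (t + 1)) F = 0)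
    {m : ℕ} (hm : m ≤ d - t) : Q ^ m ∣ F := by
  induction m with
  | zero => simp
  | succ m ih =>
    rcases exists_isHomogeneous_of_dvd (hQ.pow m) hF (ih (by omega)) with rfl | ⟨hmd, H, hH, rfl⟩
    · exact dvd_zero _
    rw [pow_succ]
    refine mul_dvd_mul_left _ (dvd_of_forall_eval_eq_zero hn hQ hdet hp0 hp hH fun v hv0 hv => ?_)
    obtain ⟨i, hi⟩ : ∃ i, eval v (pderiv i Q) ≠ 0 := by
      by_contra! hcon
      refine hv0 (Matrix.mulVec_injective_of_isUnit ((Matrix.isUnit_iff_isUnit_det _).2 hdet) ?_)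
      rw [Matrix.mulVec_zero]
      exact _root_.funext fun i => by rw [← eval_pderiv hQ, hcon]; rfl
    obtain ⟨s, hs⟩ : ∃ s, d = (s + (t + 1)) + m := ⟨d - m - (t + 1), by omega⟩
    have hX : (X i ^ m : MvPolynomial (Fin n) k).IsHomogeneous m := isHomogeneous_X_pow i m
    have hlin : ∀ r, (linForm v ^ r).IsHomogeneous r := fun r => by
      simpa using (linForm_isHomogeneous v).pow r
    -- ∂ᵢ^m strips Q^m, leaving m!(∂ᵢQ)^m H modulo Q; the remaining power of `linForm v` evaluates
    -- this at v.
    have h1 := h v hv0 hv (linForm v ^ s * X i ^ m) (by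
      rw [mul_right_comm, ← pow_add, hs]
      exact (hlin _).mul hX)
    have h2 : (diffOp k n (X i ^ m) (Q ^ m * H)).IsHomogeneous (s + (t + 1)) :=
      diffOp_isHomogeneous hX (by rwa [add_comm m, ← hs])
    rw [mul_right_comm, ← pow_add, diffOp_mul_apply, diffOp_linForm_pow v h2, C_eq_zero] at h1
    have h3 := (mul_eq_zero.1 h1).resolve_left (Nat.cast_ne_zero.2 (Nat.factorial_ne_zero _))
    obtain ⟨K, hK⟩ := dvd_diffOp_pow_mul_sub Q hX H
    have h4 := congrArg (eval v) hK
    rw [map_sub, h3, map_mul _ Q, hv, zero_mul, zero_sub, neg_eq_zero, map_mul, map_mul, eval_C,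
      map_pow, gradSubst, aeval_X, map_pow] at h4
    exact (mul_eq_zero.1 h4).resolve_left
      (mul_ne_zero (Nat.cast_ne_zero.2 m.factorial_ne_zero) (pow_ne_zero m hi))

theorem powerIdeal_points_le_perp [CharZero k] {Q : MvPolynomial (Fin n) k}
    (hQ : Q.IsHomogeneous 2) (t : ℕ) : powerIdeal (points Q) (t + 1) ≤ perp (Q ^ t) := by
  refine Ideal.span_le.2 ?_
  rintro _ ⟨v, hv, hvQ, rfl⟩
  exact diffOp_linForm_pow_eq_zero hQ ((mk_mem_points hQ hv).1 hvQ) t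

theorem perp_pow_eq_powerIdeal_points [CharZero k] (hn : 2 < n) {Q : MvPolynomial (Fin n) k}
    (hQ : Q.IsHomogeneous 2) (hdet : IsUnit (hessian Q).det) (hpt : (points Q).Nonempty) (t : ℕ) :
    perp (Q ^ t) = powerIdeal (points Q) (t + 1) := by
  refine le_antisymm (fun G hG => ?_) (powerIdeal_points_le_perp hQ t)
  obtain ⟨P, hP⟩ := hpt
  induction P using Projectivization.ind with
  | h p hp0 =>
  rw [mk_mem_points hQ] at hP
  rw [← sum_homogeneousComponent G]
  refine Ideal.sum_mem _ fun d _ => ?_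
  have hGd := homogeneousComponent_isHomogeneous d G
  have hGd0 : diffOp k n (homogeneousComponent d G) (Q ^ t) = 0 :=
    (isHomogeneous_iff_homogeneousComponent_mem _).1 (perp_isHomogeneous (hQ.pow t)) d G hG
  have hn0 : 0 < n := by omega
  rcases le_or_gt d t with hdt | hdt
  · rw [eq_zero_of_diffOp_pow_eq_zero hn0 hQ hdet hdt hGd hGd0]
    exact Ideal.zero_mem _
  by_contra hcon
  obtain ⟨φ, hφG, hφ⟩ := Submodule.exists_le_ker_of_notMem
    (p := (powerIdeal (points Q) (t + 1)).restrictScalars k) hcon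
  obtain ⟨F, hF, hFφ⟩ := exists_diffOp_right_eq d φ
  have hdvd : Q ^ (d - t) ∣ F := by
    refine pow_dvd_of_apolar (t := t) hn hQ hdet hp0 hP hF (fun v hv0 hv H hH => ?_) le_rfl
    rw [hFφ _ hH, show φ (H * linForm v ^ (t + 1)) = 0 from hφ (Ideal.mul_mem_left _ _
      (linForm_pow_mem_powerIdeal hv0 ((mk_mem_points hQ hv0).2 hv))), C_0]
  apply hφG
  rw [← C_eq_zero (σ := Fin n), ← hFφ _ hGd]
  rcases exists_isHomogeneous_of_dvd (hQ.pow (d - t)) hF hdvd with rfl | ⟨hle, H, hH, rfl⟩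
  · exact map_zero _
  -- F is K(∂) applied to Q^t, and operators commute, so G kills F although φ(G) ≠ 0.
  obtain ⟨K, -, hK⟩ := exists_diffOp_pow_eq_pow_mul hn0 hQ hdet (d - t) _ hH
  rw [show d - t + (d - 2 * (d - t)) = t by omega] at hK
  rw [← hK, ← diffOp_mul_apply, mul_comm, diffOp_mul_apply, hGd0, map_zero]

end PowerIdeal

/-! ### From grid points to all points of the quadric -/

section Grid

variable {k : Type*} [Field k] {n : ℕ}

theorem linForm_smul_add_smul (a b : k) (p q : Fin n → k) :
    linForm (a • p + b • q) = C a * linForm p + C b * linForm q := by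
  simp only [linForm, Finset.mul_sum, ← Finset.sum_add_distrib, Pi.add_apply, Pi.smul_apply,
    smul_eq_mul, C_add, C_mul]
  exact Finset.sum_congr rfl fun i _ => by ring

/-- An ideal containing the `d`-th powers of the linear forms dual to `d + 1` points of a line
contains those dual to all the points of the line. -/
theorem linForm_pow_mem_of_coord {d : ℕ} (I : Ideal (MvPolynomial (Fin n) k)) (p q : Fin n → k)
    (a b : Fin (d + 1) → k) (hab : ∀ i j, i < j → a j * b i - a i * b j ≠ 0)
    (h : ∀ i, linForm (a i • p + b i • q) ^ d ∈ I) (x y : k) :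
    linForm (x • p + y • q) ^ d ∈ I := by
  have hdet : IsUnit (Matrix.projVandermonde a b).det := by
    rw [isUnit_iff_ne_zero, Matrix.det_projVandermonde]
    exact Finset.prod_ne_zero_iff.2 fun i _ => Finset.prod_ne_zero_iff.2 fun j hj =>
      hab i j (Finset.mem_Ioi.1 hj)
  set τ : Fin (d + 1) → k := fun j => x ^ j.1 * y ^ j.rev.1 with hτ
  -- The d-th power at (x, y) is linear in the vector of degree d monomials, and the Vandermonde
  -- rows of the d + 1 given points form a basis.
  set c := Matrix.vecMul τ (Matrix.projVandermonde a b)⁻¹ with hc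
  have hcτ : ∀ j, ∑ i, c i * (a i ^ j.1 * b i ^ j.rev.1) = τ j := fun j => by
    have : Matrix.vecMul c (Matrix.projVandermonde a b) = τ := by
      rw [hc, Matrix.vecMul_vecMul, Matrix.nonsing_inv_mul _ hdet, Matrix.vecMul_one]
    exact congrFun this j
  have hexp : ∀ a b : k, linForm (a • p + b • q) ^ d = ∑ j : Fin (d + 1),
      C (a ^ j.1 * b ^ j.rev.1) *
        (linForm p ^ j.1 * linForm q ^ j.rev.1 * (d.choose j.1 : MvPolynomial (Fin n) k)) :=
    fun a b => by
      rw [linForm_smul_add_smul, add_pow, Finset.sum_range]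
      refine Finset.sum_congr rfl fun j _ => ?_
      rw [show j.rev.1 = d - j.1 by rw [Fin.val_rev]; omega]
      simp only [mul_pow, C_mul, C_pow]
      ring
  have hsum : linForm (x • p + y • q) ^ d = ∑ i, C (c i) * linForm (a i • p + b i • q) ^ d := by
    simp only [hexp, Finset.mul_sum, ← mul_assoc, ← C_mul]
    rw [Finset.sum_comm]
    refine Finset.sum_congr rfl fun j _ => ?_
    simp only [← Finset.sum_mul, ← map_sum, mul_assoc]
    rw [hcτ]
  rw [hsum]
  exact Ideal.sum_mem _ fun i _ => I.mul_mem_left _ (h i)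

/-- The pairwise disjoint subspaces serve only to make the points w i distinct: a vanishing 2 × 2
minor would give proportional vectors in two of them. -/
theorem linForm_pow_mem_of_mem_span {d : ℕ} (I : Ideal (MvPolynomial (Fin n) k)) {p q : Fin n → k}
    (N : Fin (d + 1) → Submodule k (Fin n → k)) (hN : ∀ i j, i ≠ j → Disjoint (N i) (N j))
    (w : Fin (d + 1) → Fin n → k) (hwN : ∀ i, w i ∈ N i) (hw0 : ∀ i, w i ≠ 0)
    (hw : ∀ i, w i ∈ Submodule.span k {p, q}) (h : ∀ i, linForm (w i) ^ d ∈ I) {u : Fin n → k}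
    (hu : u ∈ Submodule.span k {p, q}) : linForm u ^ d ∈ I := by
  choose a b hab using fun i => Submodule.mem_span_pair.1 (hw i)
  obtain ⟨x, y, rfl⟩ := Submodule.mem_span_pair.1 hu
  refine linForm_pow_mem_of_coord I p q a b (fun i j hij h0 => ?_)
    (fun i => by rw [hab]; exact h i) x y
  have key : ∀ r s : k, r • w i = s • w j → r = 0 := fun r s hrs => by
    have h1 : r • w i = 0 := (Submodule.disjoint_def.1 (hN i j hij.ne)) _
      ((N i).smul_mem r (hwN i)) (hrs ▸ (N j).smul_mem s (hwN j))
    exact (smul_eq_zero.1 h1).resolve_right (hw0 i)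
  have hb : b j = 0 := key _ (b i) (by
    rw [← hab, ← hab]
    simp only [smul_add, smul_smul, mul_comm (b j) (b i)]
    rw [show b j * a i = b i * a j by linear_combination -h0])
  have ha : a j = 0 := key _ (a i) (by
    rw [← hab, ← hab]
    simp only [smul_add, smul_smul, mul_comm (a j) (a i)]
    rw [show a j * b i = a i * b j by linear_combination h0])
  exact hw0 j (by rw [← hab, ha, hb, zero_smul, zero_smul, add_zero])

theorem exists_span_pair_of_finrank_eq_two {V : Type*} [AddCommGroup V] [Module k V]
    {L : Submodule k V} (h : Module.finrank k L = 2) : ∃ p q, L = Submodule.span k {p, q} := by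
  have : Module.Finite k L := Module.finite_of_finrank_pos (by omega)
  let b := Module.finBasisOfFinrankEq k L h
  refine ⟨b 0, b 1, ?_⟩
  have hb := congrArg (Submodule.map L.subtype) b.span_eq
  rw [Submodule.map_span, Submodule.map_top, Submodule.range_subtype, ← Set.range_comp] at hb
  refine hb.symm.trans (congrArg _ ?_)
  ext x
  simp [Fin.exists_fin_two, eq_comm]

theorem polar_eq_zero {Q : MvPolynomial (Fin n) k} [CharZero k] (hQ : Q.IsHomogeneous 2)
    {L : Submodule k (Fin n → k)} (hL : IsLineOn Q L) {x y : Fin n → k} (hx : x ∈ L) (hy : y ∈ L) :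
    x ⬝ᵥ (hessian Q).mulVec y = 0 := by
  have h := eval_add_eq hQ x y
  rw [hL.2 x hx, hL.2 y hy, hL.2 _ (L.add_mem hx hy)] at h
  simpa using h.symm

theorem gridPoints_subset_points {Q : MvPolynomial (Fin 4) k} {a b : ℕ}
    {L : Fin a → Submodule k (Fin 4 → k)} {M : Fin b → Submodule k (Fin 4 → k)}
    (h : IsGrid Q L M) : gridPoints L M ⊆ points Q := by
  rintro P ⟨i, j, hP⟩ v hv
  exact (h.lineOn_left i).2 v (hP hv).1

/-- The line meets the t + 2 lines of the opposite family in distinct grid points, one more than the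
exponent t + 1. -/
theorem linForm_pow_mem_of_mem_left {Q : MvPolynomial (Fin 4) k} {a t : ℕ}
    {L : Fin a → Submodule k (Fin 4 → k)} {M : Fin (t + 2) → Submodule k (Fin 4 → k)}
    (h : IsGrid Q L M) (i : Fin a) {u : Fin 4 → k} (hu : u ∈ L i) :
    linForm u ^ (t + 1) ∈ powerIdeal (gridPoints L M) (t + 1) := by
  have hex : ∀ j, ∃ w ∈ L i ⊓ M j, w ≠ 0 := fun j =>
    Submodule.exists_mem_ne_zero_of_ne_bot fun hbot =>
      h.opposite i j (Or.inr (disjoint_iff.2 hbot))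
  choose w hw hw0 using hex
  obtain ⟨p, q, hpq⟩ := exists_span_pair_of_finrank_eq_two (h.lineOn_left i).1
  refine linForm_pow_mem_of_mem_span _ M
    (fun j j' hj => (h.ruling_right j j').resolve_left (h.injective_right.ne hj)) w
    (fun j => (hw j).2) hw0 (fun j => hpq ▸ (hw j).1) (fun j => ?_) (hpq ▸ hu)
  refine linForm_pow_mem_powerIdeal (hw0 j) ⟨i, j, ?_⟩
  rw [Projectivization.submodule_mk, Submodule.span_singleton_le_iff_mem]
  exact hw j

/-- Through every rational point of a quadric containing at least two skew lines passes a line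
meeting all the lines of their ruling. -/
theorem exists_transversal [CharZero k] {Q : MvPolynomial (Fin 4) k} (hQ : Q.IsHomogeneous 2)
    (hdet : IsUnit (hessian Q).det) {a : ℕ} {L : Fin (a + 2) → Submodule k (Fin 4 → k)}
    (hL : ∀ i, IsLineOn Q (L i)) (hdisj : ∀ i j, i ≠ j → Disjoint (L i) (L j))
    {v : Fin 4 → k} (hv : eval v Q = 0) (hvL : ∀ i, v ∉ L i) :
    ∃ q, ∀ i, ∃ w ∈ L i, w ≠ 0 ∧ w ∈ Submodule.span k {v, q} := by
  have htop : ∀ i, i ≠ 0 → L 0 ⊔ L i = ⊤ := fun i hi => by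
    refine Submodule.eq_top_of_finrank_eq ?_
    have h := Submodule.finrank_sup_add_finrank_inf_eq (L 0) (L i)
    rw [(hdisj 0 i hi.symm).eq_bot, finrank_bot, (hL 0).1, (hL i).1] at h
    simpa using h
  have hdec : ∀ i, i ≠ 0 → ∃ x ∈ L 0, ∃ y ∈ L i, x + y = v := fun i hi =>
    Submodule.mem_sup.1 (htop i hi ▸ Submodule.mem_top)
  have h10 : (1 : Fin (a + 2)) ≠ 0 := by simp
  obtain ⟨x₁, hx₁, y₁, hy₁, hxy₁⟩ := hdec 1 h10
  have hx₁0 : x₁ ≠ 0 := by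
    rintro rfl
    exact hvL 1 (by rwa [← hxy₁, zero_add])
  let f : L 0 →ₗ[k] k :=
    (dotProductBilin k k ((hessian Q).mulVec v)) ∘ₗ (L 0).subtype
  have hf : ∀ x : L 0, f x = x.1 ⬝ᵥ (hessian Q).mulVec v := fun x => by
    rw [dotProduct_comm]
    rfl
  -- Since v, x, y are all isotropic, x is orthogonal to y, hence to v = x + y.
  have hfx : ∀ i x y (hx : x ∈ L 0), y ∈ L i → x + y = v → f ⟨x, hx⟩ = 0 := by
    rintro i x y hx hy rfl
    have h := eval_add_eq hQ x y
    rw [hv, (hL 0).2 x hx, (hL i).2 y hy, zero_add, add_zero] at h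
    rw [hf, Matrix.mulVec_add, dotProduct_add, polar_eq_zero hQ (hL 0) hx hx, ← h, zero_add]
  -- Otherwise y₁ would be orthogonal to both L 0 and L 1, which span the space.
  have hf0 : f ≠ 0 := by
    intro h0
    have hy0 : (hessian Q).mulVec y₁ = 0 := by
      refine dotProduct_eq_zero _ fun z => ?_
      rw [dotProduct_comm]
      obtain ⟨z₀, hz₀, z₁, hz₁, rfl⟩ :=
        Submodule.mem_sup.1 (htop 1 h10 ▸ Submodule.mem_top (x := z))
      have h1 : f ⟨z₀, hz₀⟩ = 0 := by rw [h0]; rfl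
      rw [hf, ← hxy₁, Matrix.mulVec_add, dotProduct_add, polar_eq_zero hQ (hL 0) hz₀ hx₁,
        zero_add] at h1
      rw [add_dotProduct, h1, polar_eq_zero hQ (hL 1) hz₁ hy₁, add_zero]
    have : y₁ = 0 := Matrix.mulVec_injective_of_isUnit
      ((Matrix.isUnit_iff_isUnit_det _).2 hdet) (by rw [hy0, Matrix.mulVec_zero])
    exact hvL 0 (by rwa [← hxy₁, this, add_zero])
  have hker : Module.finrank k (LinearMap.ker f) = 1 := by
    have h1 := f.finrank_range_add_finrank_ker
    have h2 : Module.finrank k (LinearMap.range f) = 1 := by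
      rw [LinearMap.range_eq_top.2 (LinearMap.surjective hf0), finrank_top, Module.finrank_self]
    rw [h2, (hL 0).1] at h1
    omega
  -- The components in L 0 of all the decompositions of v are thus multiples of x₁, so one line
  -- through v and x₁ meets every L i.
  have hprop := (finrank_eq_one_iff_of_nonzero'
    (⟨⟨x₁, hx₁⟩, hfx 1 x₁ y₁ hx₁ hy₁ hxy₁⟩ : LinearMap.ker f) (fun h => hx₁0
      (congrArg (fun z : LinearMap.ker f => z.1.1) h))).1 hker
  refine ⟨x₁, fun i => ?_⟩
  by_cases hi : i = 0
  · subst hi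
    exact ⟨x₁, hx₁, hx₁0, Submodule.subset_span (by simp)⟩
  obtain ⟨x, hx, y, hy, hxy⟩ := hdec i hi
  obtain ⟨c, hc⟩ := hprop ⟨⟨x, hx⟩, hfx i x y hx hy hxy⟩
  have hc' : c • x₁ = x := congrArg (fun z : LinearMap.ker f => z.1.1) hc
  refine ⟨y, hy, ?_, Submodule.mem_span_pair.2 ⟨1, -c, ?_⟩⟩
  · rintro rfl
    exact hvL 0 (by rwa [← hxy, add_zero])
  · rw [neg_smul, hc', ← hxy, one_smul]
    abel

theorem powerIdeal_gridPoints_eq [CharZero k] {Q : MvPolynomial (Fin 4) k}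
    (hQ : Q.IsHomogeneous 2) (hdet : IsUnit (hessian Q).det) {t : ℕ}
    {L M : Fin (t + 2) → Submodule k (Fin 4 → k)} (h : IsGrid Q L M) :
    powerIdeal (gridPoints L M) (t + 1) = powerIdeal (points Q) (t + 1) := by
  refine le_antisymm (powerIdeal_mono (gridPoints_subset_points h) _) (Ideal.span_le.2 ?_)
  rintro _ ⟨v, hv0, hv, rfl⟩
  rw [mk_mem_points hQ] at hv
  by_cases hvL : ∃ i, v ∈ L i
  · obtain ⟨i, hi⟩ := hvL
    exact linForm_pow_mem_of_mem_left h i hi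
  have hdisj : ∀ i j, i ≠ j → Disjoint (L i) (L j) := fun i j hij =>
    (h.ruling_left i j).resolve_left (h.injective_left.ne hij)
  obtain ⟨q, hq⟩ := exists_transversal hQ hdet h.lineOn_left hdisj hv (not_exists.1 hvL)
  choose w hwL hw0 hw using hq
  exact linForm_pow_mem_of_mem_span _ L hdisj w hwL hw0 hw
    (fun i => linForm_pow_mem_of_mem_left h i (hwL i)) (Submodule.subset_span (by simp))

theorem points_nonempty_of_isLineOn {Q : MvPolynomial (Fin n) k} [CharZero k]
    (hQ : Q.IsHomogeneous 2) {L : Submodule k (Fin n → k)} (hL : IsLineOn Q L) :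
    (points Q).Nonempty := by
  have hbot : L ≠ ⊥ := by
    rintro rfl
    simpa using hL.1
  obtain ⟨v, hv, hv0⟩ := Submodule.exists_mem_ne_zero_of_ne_bot hbot
  exact ⟨Projectivization.mk k v hv0, (mk_mem_points hQ hv0).2 (hL.2 v hv)⟩

end Grid

/-! ### Grids over an algebraically closed field -/

section GridExistence

variable {k : Type*} [Field k]

theorem toQuadraticForm'_apply {n : ℕ} (A : Matrix (Fin n) (Fin n) k) (v : Fin n → k) :
    A.toQuadraticForm' v = v ⬝ᵥ A.mulVec v :=
  Matrix.toLinearMap₂'_apply' A v v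

theorem associated_toQuadraticForm'_separatingLeft [CharZero k] {n : ℕ}
    {A : Matrix (Fin n) (Fin n) k} (hA : A.transpose = A) (hdet : IsUnit A.det) :
    (QuadraticMap.associated (R := k) A.toQuadraticForm').SeparatingLeft := by
  have h : QuadraticMap.associated (R := k) A.toQuadraticForm' = Matrix.toLinearMap₂' k A :=
    QuadraticMap.associated_left_inverse k fun x y => by
      rw [Matrix.toLinearMap₂'_apply', Matrix.toLinearMap₂'_apply', Matrix.dotProduct_mulVec,
        ← Matrix.mulVec_transpose, hA, dotProduct_comm]
  rw [h]
  exact LinearMap.separatingLeft_toLinearMap₂'_of_det_ne_zero' hdet.ne_zero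

/-- Over an algebraically closed field, a smooth quadric surface is `x₀x₁ + x₂x₃ = 0` in suitable
coordinates. -/
theorem exists_linearEquiv_eval_eq [CharZero k] [IsAlgClosed k] {Q : MvPolynomial (Fin 4) k}
    (hQ : Q.IsHomogeneous 2) (hdet : IsUnit (hessian Q).det) :
    ∃ e : (Fin 4 → k) ≃ₗ[k] (Fin 4 → k), ∀ x, eval (e x) Q = x 0 * x 1 + x 2 * x 3 := by
  let S : Matrix (Fin 4) (Fin 4) k := !![0, 1, 0, 0; 1, 0, 0, 0; 0, 0, 0, 1; 0, 0, 1, 0]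
  have hS : S.transpose = S := by
    ext i j
    fin_cases i <;> fin_cases j <;> rfl
  have hSS : S * S = 1 := by
    ext i j
    fin_cases i <;> fin_cases j <;> simp [S, Matrix.mul_apply, Fin.sum_univ_four]
  have hSdet : IsUnit S.det := IsUnit.of_mul_eq_one S.det (by
    rw [← Matrix.det_mul, hSS, Matrix.det_one])
  obtain ⟨e⟩ := QuadraticForm.equivalent_of_isAlgClosed S.toQuadraticForm'
    (hessian Q).toQuadraticForm' (associated_toQuadraticForm'_separatingLeft hS hSdet)
    (associated_toQuadraticForm'_separatingLeft (hessian_transpose Q) hdet)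
  refine ⟨e.toLinearEquiv, fun x => ?_⟩
  have h := e.map_app x
  rw [toQuadraticForm'_apply, toQuadraticForm'_apply, ← two_mul_eval hQ] at h
  -- Both matrices represent twice the quadric in question, hence the factor 2.
  refine mul_left_cancel₀ (two_ne_zero (α := k)) (h.trans ?_)
  simp [S, dotProduct, Matrix.mulVec, Fin.sum_univ_four]
  ring

theorem mulVecLin_left (s : k) (y : Fin 2 → k) :
    Matrix.mulVecLin !![1, 0; 0, -s; s, 0; 0, 1] y = ![y 0, -s * y 1, s * y 0, y 1] := by
  ext i
  fin_cases i <;> simp [Matrix.mulVec, dotProduct, Fin.sum_univ_two]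

theorem mulVecLin_right (s : k) (y : Fin 2 → k) :
    Matrix.mulVecLin !![1, 0; 0, -s; 0, 1; s, 0] y = ![y 0, -s * y 1, y 1, s * y 0] := by
  ext i
  fin_cases i <;> simp [Matrix.mulVec, dotProduct, Fin.sum_univ_two]

theorem exists_isGrid [CharZero k] [IsAlgClosed k] {Q : MvPolynomial (Fin 4) k}
    (hQ : Q.IsHomogeneous 2)
    (hdet : IsUnit (hessian Q).det) (a b : ℕ) :
    ∃ (L : Fin a → Submodule k (Fin 4 → k)) (M : Fin b → Submodule k (Fin 4 → k)),
      IsGrid Q L M := by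
  obtain ⟨e, he⟩ := exists_linearEquiv_eval_eq hQ hdet
  -- The two rulings of x₀x₁ + x₂x₃ = 0, exchanged by swapping the last two coordinates. Integer
  -- parameters, distinct in characteristic zero, select the lines.
  let f (s : k) : (Fin 2 → k) →ₗ[k] (Fin 4 → k) :=
    e.toLinearMap ∘ₗ Matrix.mulVecLin !![1, 0; 0, -s; s, 0; 0, 1]
  let g (s : k) : (Fin 2 → k) →ₗ[k] (Fin 4 → k) :=
    e.toLinearMap ∘ₗ Matrix.mulVecLin !![1, 0; 0, -s; 0, 1; s, 0]
  have hf : ∀ s y, f s y = e ![y 0, -s * y 1, s * y 0, y 1] := fun s y =>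
    congrArg e (mulVecLin_left s y)
  have hg : ∀ s y, g s y = e ![y 0, -s * y 1, y 1, s * y 0] := fun s y =>
    congrArg e (mulVecLin_right s y)
  have hff : ∀ s s' y y', f s y = f s' y' → y = y' ∧ s * y 0 = s' * y' 0 ∧ s * y 1 = s' * y' 1 := by
    intro s s' y y' h
    rw [hf, hf] at h
    have h := e.injective h
    have h0 : y 0 = y' 0 := congrFun h 0
    have h1 : -s * y 1 = -s' * y' 1 := congrFun h 1
    have h2 : s * y 0 = s' * y' 0 := congrFun h 2
    have h3 : y 1 = y' 1 := congrFun h 3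
    refine ⟨?_, h2, by linear_combination -h1⟩
    ext i
    fin_cases i
    exacts [h0, h3]
  have hgg : ∀ s s' y y', g s y = g s' y' → y = y' ∧ s * y 0 = s' * y' 0 ∧ s * y 1 = s' * y' 1 := by
    intro s s' y y' h
    rw [hg, hg] at h
    have h := e.injective h
    have h0 : y 0 = y' 0 := congrFun h 0
    have h1 : -s * y 1 = -s' * y' 1 := congrFun h 1
    have h2 : y 1 = y' 1 := congrFun h 2
    have h3 : s * y 0 = s' * y' 0 := congrFun h 3
    refine ⟨?_, h3, by linear_combination -h1⟩
    ext i
    fin_cases i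
    exacts [h0, h2]
  have hline : ∀ φ : (Fin 2 → k) →ₗ[k] (Fin 4 → k), (∀ y y', φ y = φ y' → y = y') →
      (∀ y, eval (φ y) Q = 0) → IsLineOn Q (LinearMap.range φ) := fun φ hφ h0 => by
    refine ⟨?_, ?_⟩
    · rw [LinearMap.finrank_range_of_inj hφ, Module.finrank_fin_fun]
    · rintro _ ⟨y, rfl⟩
      exact h0 y
  have hfl : ∀ s, IsLineOn Q (LinearMap.range (f s)) := fun s =>
    hline _ (fun y y' h => (hff s s y y' h).1) fun y => by
      rw [hf, he]
      simp
      ring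
  have hgl : ∀ s, IsLineOn Q (LinearMap.range (g s)) := fun s =>
    hline _ (fun y y' h => (hgg s s y y' h).1) fun y => by
      rw [hg, he]
      simp
      ring
  have hdisj : ∀ φ : k → (Fin 2 → k) →ₗ[k] (Fin 4 → k), (∀ s s' y y', φ s y = φ s' y' →
      y = y' ∧ s * y 0 = s' * y' 0 ∧ s * y 1 = s' * y' 1) → ∀ s s', s ≠ s' →
      Disjoint (LinearMap.range (φ s)) (LinearMap.range (φ s')) := by
    intro φ hφ s s' hs
    rw [Submodule.disjoint_def]
    rintro _ ⟨y, rfl⟩ ⟨y', h⟩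
    obtain ⟨rfl, h0, h1⟩ := hφ _ _ _ _ h
    have hs' : s' - s ≠ 0 := sub_ne_zero.2 hs.symm
    have hy : y' = 0 := by
      ext i
      fin_cases i
      · exact (mul_eq_zero.1 (show (s' - s) * y' 0 = 0 by linear_combination h0)).resolve_left hs'
      · exact (mul_eq_zero.1 (show (s' - s) * y' 1 = 0 by linear_combination h1)).resolve_left hs'
    rw [hy, map_zero]
  have hcast : ∀ (c : ℕ) (i j : Fin c), i ≠ j → ((i : ℕ) : k) ≠ ((j : ℕ) : k) := fun c i j h h' =>
    h (Fin.ext (Nat.cast_injective h'))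
  have hne : ∀ s, (∃ y, f s y ≠ 0) ∧ ∃ y, g s y ≠ 0 := fun s => by
    have h1 : (![1, 0] : Fin 2 → k) ≠ 0 := fun h => one_ne_zero (congrFun h 0)
    exact ⟨⟨_, fun h => h1 (hff s s _ 0 (h.trans (map_zero _).symm)).1⟩,
      ⟨_, fun h => h1 (hgg s s _ 0 (h.trans (map_zero _).symm)).1⟩⟩
  have hrange : ∀ φ : (Fin 2 → k) →ₗ[k] (Fin 4 → k), (∃ y, φ y ≠ 0) → LinearMap.range φ ≠ ⊥ := by
    rintro φ ⟨y, hy⟩ h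
    rw [LinearMap.range_eq_bot] at h
    exact hy (by rw [h]; rfl)
  have hinj : ∀ {c : ℕ} (N : Fin c → Submodule k (Fin 4 → k)), (∀ i, N i ≠ ⊥) →
      (∀ i j, i ≠ j → Disjoint (N i) (N j)) → Function.Injective N := by
    intro c N hN hd i j hij
    by_contra h
    have := hd i j h
    rw [hij, disjoint_self] at this
    exact hN j this
  have hfd : ∀ i j : Fin a, i ≠ j → Disjoint (LinearMap.range (f (i : ℕ)))
      (LinearMap.range (f (j : ℕ))) := fun i j h => hdisj f hff _ _ (hcast a i j h)
  have hgd : ∀ i j : Fin b, i ≠ j → Disjoint (LinearMap.range (g (i : ℕ)))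
      (LinearMap.range (g (j : ℕ))) := fun i j h => hdisj g hgg _ _ (hcast b i j h)
  refine ⟨fun i => LinearMap.range (f (i : ℕ)), fun j => LinearMap.range (g (j : ℕ)),
    fun i => hfl _, fun j => hgl _, hinj _ (fun i => hrange _ (hne _).1) hfd,
    hinj _ (fun i => hrange _ (hne _).2) hgd,
    fun i i' => or_iff_not_imp_left.2 fun h => hfd i i' fun h' => h (by rw [h']),
    fun i i' => or_iff_not_imp_left.2 fun h => hgd i i' fun h' => h (by rw [h']), ?_⟩
  intro i j h
  rcases h with h | h
  · have hmem : f (i : ℕ) ![0, 1] ∈ LinearMap.range (g (j : ℕ)) := h ▸ ⟨_, rfl⟩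
    obtain ⟨y, hy⟩ := hmem
    rw [hf, hg] at hy
    have hy := e.injective hy
    have h0 : y 0 = 0 := congrFun hy 0
    have h3 : ((j : ℕ) : k) * y 0 = 1 := congrFun hy 3
    rw [h0, mul_zero] at h3
    exact zero_ne_one h3
  -- Lines i and j of opposite rulings share the point with coordinates (1, -ij, i, j).
  · have hfg : f (i : ℕ) ![1, ((j : ℕ) : k)] = g (j : ℕ) ![1, ((i : ℕ) : k)] := by
      rw [hf, hg]
      congr 1
      ext l
      fin_cases l <;> simp [mul_comm]
    have h0 := Submodule.disjoint_def.1 h _ ⟨_, rfl⟩ ⟨_, hfg.symm⟩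
    have := congrFun (hff _ _ _ 0 (h0.trans (map_zero (f (i : ℕ))).symm)).1 0
    exact one_ne_zero this

end GridExistence

end QuadricPowers

end

theorem mainTheorem2 {k : Type*} [Field k] [CharZero k]
    (Q : MvPolynomial (Fin 4) k) (hQ : Q.IsHomogeneous 2)
    (hsmooth : QuadricPowers.IsSmoothHypersurface Q) (t : ℕ) :
    -- the description of `(Q^t)^⊥` by powers of linear forms
    ((QuadricPowers.points Q).Nonempty →
      QuadricPowers.perp (Q ^ t) = QuadricPowers.powerIdeal (QuadricPowers.points Q) (t + 1)) ∧
    -- `R/(Q^t)^⊥` is compressed Gorenstein, of socle degree `2t`, with explicit Hilbert function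
    QuadricPowers.IsCompressedGorenstein (QuadricPowers.perp (Q ^ t)) (2 * t) ∧
    (∀ i ≤ 2 * t, QuadricPowers.hilbertFn (QuadricPowers.perp (Q ^ t)) i =
      min ((i + 3).choose 3) ((2 * t - i + 3).choose 3)) ∧
    -- the points of any `(t+2) × (t+2)` grid on the quadric suffice
    (∀ L M : Fin (t + 2) → Submodule k (Fin 4 → k), QuadricPowers.IsGrid Q L M →
      QuadricPowers.perp (Q ^ t) =
        QuadricPowers.powerIdeal (QuadricPowers.gridPoints L M) (t + 1)) ∧
    -- such grids exist over an algebraically closed field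
    (IsAlgClosed k → ∃ L M : Fin (t + 2) → Submodule k (Fin 4 → k), QuadricPowers.IsGrid Q L M) := by
  have hdet := QuadricPowers.isUnit_det_hessian hQ hsmooth
  refine ⟨fun h => QuadricPowers.perp_pow_eq_powerIdeal_points (by norm_num) hQ hdet h t,
    QuadricPowers.perp_pow_isCompressedGorenstein four_pos hQ hdet t,
    fun i hi => QuadricPowers.hilbertFn_perp_pow_four hQ hdet hi, fun L M h => ?_,
    fun _ => QuadricPowers.exists_isGrid hQ hdet _ _⟩
  rw [QuadricPowers.powerIdeal_gridPoints_eq hQ hdet h]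
  exact QuadricPowers.perp_pow_eq_powerIdeal_points (by norm_num) hQ hdet
    (QuadricPowers.points_nonempty_of_isLineOn hQ (h.lineOn_left 0)) t
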